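/- Let $O(3)$ act in the standard way on the round unit sphere $S^2\subset\mathbb{R}^3$, whose distance is $d(x,y)=\arccos\langle x,y\rangle$. For a closed subgroup $G\le O(3)$ let $S^2/G$ be the orbit space with the quotient metric $d(Gx,Gy)=\min_{g,h\in G}d(gx,hy)$, and let $\operatorname{diam}(S^2/G)$ be its diameter. Put $$\alpha=\arccos\!\left(\frac{\tan(3\pi/10)}{\sqrt 3}\right).$$ If $G$ is a closed subgroup of $O(3)$ that does not act transitively on $S^2$, then $$\operatorname{diam}(S^2/G)\ \ge\ \alpha .$$ The bound is attained by the icosahedral groups: let $I^h\le O(3)$ be the full symmetry group of a regular icosahedron centred at the origin and let $I=I^h\cap SO(3)$ be its rotation group. Both $I$ and $I^h$ are closed and do not act transitively on $S^2$, and $$\operatorname{diam}(S^2/I)=\operatorname{diam}(S^2/I^h)=\alpha .$$ -/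

import Mathlib

open scoped Pointwise goldenRatio

/-- Euclidean three-space. -/
abbrev E3 : Type := EuclideanSpace ℝ (Fin 3)

/-- The unit sphere `S²` in `ℝ³`. -/
abbrev S2 : Type := Metric.sphere (0 : E3) 1

/-- The orthogonal group `O(3)`, with the topology induced from the space of `3 × 3` matrices. -/
abbrev O3 : Type := Matrix.orthogonalGroup (Fin 3) ℝ

/-- Mathlib's action of `O(3)` on `ℝ³` is the standard one, `A • x = A x`. -/
theorem O3.smul_def (A : O3) (x : E3) : A • x = WithLp.toLp 2 (A.1.mulVec x.ofLp) := rfl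

theorem O3.inner_smul_smul (A : O3) (x y : E3) : inner ℝ (A • x) (A • y) = inner ℝ x y := by
  have h : A.1.transpose * A.1 = 1 := (Matrix.mem_orthogonalGroup_iff' (Fin 3) ℝ).1 A.2
  simp only [O3.smul_def, EuclideanSpace.inner_eq_star_dotProduct, star_trivial]
  rw [Matrix.dotProduct_mulVec, ← Matrix.mulVec_transpose, Matrix.mulVec_mulVec, h,
    Matrix.one_mulVec]

theorem O3.norm_smul_eq (A : O3) (x : E3) : ‖A • x‖ = ‖x‖ := by
  rw [norm_eq_sqrt_real_inner, norm_eq_sqrt_real_inner, O3.inner_smul_smul]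

/-- The action of `O(3)` on the unit sphere. -/
instance O3.mulActionS2 : MulAction O3 S2 where
  smul A x := ⟨A • (x : E3), by
    rw [mem_sphere_zero_iff_norm, O3.norm_smul_eq]; exact mem_sphere_zero_iff_norm.1 x.2⟩
  one_smul x := Subtype.ext (one_smul O3 (x : E3))
  mul_smul A B x := Subtype.ext (mul_smul A B (x : E3))

theorem O3.coe_smul (A : O3) (x : S2) : ((A • x : S2) : E3) = A • (x : E3) := rfl

/-- The geodesic distance of the round unit sphere: `d(x, y) = arccos ⟪x, y⟫`, the angle
between the two unit vectors. -/
noncomputable def sphereDist (x y : S2) : ℝ := InnerProductGeometry.angle (x : E3) (y : E3)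

theorem sphereDist_smul_smul (A : O3) (x y : S2) :
    sphereDist (A • x) (A • y) = sphereDist x y := by
  simp only [sphereDist, InnerProductGeometry.angle, O3.coe_smul, O3.inner_smul_smul,
    O3.norm_smul_eq]

/-- The orbit space `S²/G` of a subgroup `G` of `O(3)`. -/
def OrbitSpace (G : Subgroup O3) : Type := MulAction.orbitRel.Quotient G S2

/-- The orbit `Gx`, as a point of `S²/G`. -/
def orbitMk (G : Subgroup O3) (x : S2) : OrbitSpace G :=
  Quotient.mk (MulAction.orbitRel G S2) x

theorem orbitMk_surjective (G : Subgroup O3) : Function.Surjective (orbitMk G) :=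
  Quotient.mk_surjective

theorem orbitMk_eq_iff (G : Subgroup O3) (x y : S2) :
    orbitMk G x = orbitMk G y ↔ ∃ g ∈ G, g • y = x := by
  have h : orbitMk G x = orbitMk G y ↔ x ∈ MulAction.orbit G y :=
    Quotient.eq (r := MulAction.orbitRel G S2)
  rw [h, MulAction.mem_orbit_iff]
  exact ⟨fun ⟨g, hg⟩ => ⟨g.1, g.2, hg⟩, fun ⟨g, hg, h⟩ => ⟨⟨g, hg⟩, h⟩⟩

/-- The set of distances between a point of the orbit `a` and a point of the orbit `b`. -/
def orbitDistSet (G : Subgroup O3) (a b : OrbitSpace G) : Set ℝ :=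
  {d | ∃ x y : S2, orbitMk G x = a ∧ orbitMk G y = b ∧ sphereDist x y = d}

/-- The distance of two orbits: the infimum of the distances between their points. -/
noncomputable def orbitDist (G : Subgroup O3) (a b : OrbitSpace G) : ℝ :=
  sInf (orbitDistSet G a b)

theorem orbitDistSet_nonempty (G : Subgroup O3) (a b : OrbitSpace G) :
    (orbitDistSet G a b).Nonempty := by
  obtain ⟨x, rfl⟩ := orbitMk_surjective G a
  obtain ⟨y, rfl⟩ := orbitMk_surjective G b
  exact ⟨_, x, y, rfl, rfl, rfl⟩

theorem orbitDistSet_bddBelow (G : Subgroup O3) (a b : OrbitSpace G) :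
    BddBelow (orbitDistSet G a b) := by
  refine ⟨0, ?_⟩
  rintro _ ⟨x, y, -, -, rfl⟩
  exact InnerProductGeometry.angle_nonneg _ _

theorem orbitDist_le (G : Subgroup O3) (x y : S2) :
    orbitDist G (orbitMk G x) (orbitMk G y) ≤ sphereDist x y :=
  csInf_le (orbitDistSet_bddBelow G _ _) ⟨x, y, rfl, rfl, rfl⟩

theorem orbitDist_nonneg (G : Subgroup O3) (a b : OrbitSpace G) : 0 ≤ orbitDist G a b := by
  refine le_csInf (orbitDistSet_nonempty G a b) ?_
  rintro _ ⟨x, y, -, -, rfl⟩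
  exact InnerProductGeometry.angle_nonneg _ _

theorem orbitDist_self (G : Subgroup O3) (a : OrbitSpace G) : orbitDist G a a = 0 := by
  refine le_antisymm ?_ (orbitDist_nonneg G a a)
  obtain ⟨x, rfl⟩ := orbitMk_surjective G a
  refine (orbitDist_le G x x).trans_eq (InnerProductGeometry.angle_self ?_)
  exact ne_zero_of_mem_unit_sphere x

theorem orbitDist_comm (G : Subgroup O3) (a b : OrbitSpace G) :
    orbitDist G a b = orbitDist G b a := by
  have h : orbitDistSet G a b = orbitDistSet G b a := by
    ext d
    constructor
    · rintro ⟨x, y, hx, hy, h⟩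
      exact ⟨y, x, hy, hx, (InnerProductGeometry.angle_comm _ _).trans h⟩
    · rintro ⟨x, y, hx, hy, h⟩
      exact ⟨y, x, hy, hx, (InnerProductGeometry.angle_comm _ _).trans h⟩
  rw [orbitDist, orbitDist, h]

theorem orbitDist_triangle (G : Subgroup O3) (a b c : OrbitSpace G) :
    orbitDist G a c ≤ orbitDist G a b + orbitDist G b c := by
  refine le_of_forall_pos_lt_add fun ε hε => ?_
  obtain ⟨_, ⟨x, y, rfl, rfl, rfl⟩, h1⟩ := exists_lt_of_csInf_lt (orbitDistSet_nonempty G a b)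
    (show sInf (orbitDistSet G a b) < orbitDist G a b + ε / 2 from lt_add_of_pos_right _ (by linarith))
  obtain ⟨_, ⟨y', z, hy, rfl, rfl⟩, h2⟩ :=
    exists_lt_of_csInf_lt (orbitDistSet_nonempty G (orbitMk G y) c)
    (show sInf (orbitDistSet G (orbitMk G y) c) < orbitDist G (orbitMk G y) c + ε / 2 from
      lt_add_of_pos_right _ (by linarith))
  obtain ⟨g, hg, rfl⟩ := (orbitMk_eq_iff G y' y).1 hy
  have hx : orbitMk G (g • x) = orbitMk G x := (orbitMk_eq_iff G _ _).2 ⟨g, hg, rfl⟩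
  have h3 := orbitDist_le G (g • x) z
  rw [hx] at h3
  have h4 : sphereDist (g • x) z ≤ sphereDist (g • x) (g • y) + sphereDist (g • y) z :=
    InnerProductGeometry.angle_le_angle_add_angle _ _ _
  rw [sphereDist_smul_smul] at h4
  linarith

/-- The quotient metric on `S²/G` (it is a genuine metric when `G` is closed). -/
noncomputable instance OrbitSpace.pseudoMetricSpace (G : Subgroup O3) :
    PseudoMetricSpace (OrbitSpace G) where
  dist := orbitDist G
  dist_self := orbitDist_self G
  dist_comm := orbitDist_comm G
  dist_triangle := orbitDist_triangle G

/-- The diameter of `S²/G`. -/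
noncomputable def orbitSpaceDiam (G : Subgroup O3) : ℝ :=
  Metric.diam (Set.univ : Set (OrbitSpace G))

/-- The twelve vertices `(0, ±1, ±φ)`, `(±1, ±φ, 0)`, `(±φ, 0, ±1)` of a regular icosahedron
centred at the origin, where `φ` is the golden ratio. -/
noncomputable def icosahedronVertices : Set E3 :=
  {v | ∃ s t : ℝ, (s = 1 ∨ s = -1) ∧ (t = 1 ∨ t = -1) ∧
    (v = !₂[0, s, t * φ] ∨ v = !₂[s, t * φ, 0] ∨ v = !₂[t * φ, 0, s])}

/-- The full icosahedral group `I^h`: all orthogonal symmetries of the regular icosahedron. -/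
noncomputable def fullIcosahedralGroup : Subgroup O3 :=
  MulAction.stabilizer O3 icosahedronVertices

/-- The icosahedral group `I`: the symmetries of the regular icosahedron lying in `SO(3)`. -/
noncomputable def icosahedralGroup : Subgroup O3 where
  carrier := {A | A ∈ fullIcosahedralGroup ∧ A.1.det = 1}
  one_mem' := ⟨one_mem _, Matrix.det_one⟩
  mul_mem' := by
    rintro A B ⟨hA, hA'⟩ ⟨hB, hB'⟩
    refine ⟨mul_mem hA hB, ?_⟩
    change (A.1 * B.1).det = 1
    rw [Matrix.det_mul, hA', hB', one_mul]
  inv_mem' := by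
    rintro A ⟨hA, hA'⟩
    refine ⟨inv_mem hA, ?_⟩
    change (star A.1).det = 1
    rw [Matrix.star_eq_conjTranspose, Matrix.det_conjTranspose, hA', star_one]

/-- The constant `α = arccos (tan (3π/10) / √3)`. -/
noncomputable def alphaAngle : ℝ :=
  Real.arccos (Real.tan (3 * Real.pi / 10) / Real.sqrt 3)

/-! Lower bound. It suffices to find two points `x`, `w` with `⟪g x, w⟫ ≤ cos α` for all `g ∈ G`
(`alphaAngle_le_diam`), where `cos² α = (1 + 2/√5)/3`.

If `G` is infinite, compactness gives a nonzero infinitesimal rotation with axis `ω`, a limit of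
rescaled differences `g - 1`. For `x`, `w` in different orbits, let `y` be the point of `Gx` nearest
to `w`. The first variation of `⟪g y, w⟫` vanishes, also after conjugation by `G`, so the orbits of
`ω` and of `y × w` are orthogonal and lie at distance `π/2 ≥ α`. The degenerate case `y = -w` forces
`G` to fix `w`.

If `G` is finite, replace it by the rotations among `±A`, `A ∈ G`, and bound `|⟪g x, w⟫|`. Klein's
count of poles (`exists_pole`) gives a point `p` whose orbit has at most two elements, or whose
stabiliser and orbit have orders (3, 4), (4, 6) or (5, 12). The lines through the orbit are then
controlled by counting alone: they are orthogonal in the octahedral case, equiangular in the other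
two. A sum of two or three spanning vectors is far enough from all of these lines. Only the face
centre of the icosahedron attains `cos α`.

Upper bound. `I` moves every point into the cone over a kite spanned by a vertex, a face centre and
two edge midpoints of the icosahedron (`exists_mem_kite`). Any two of these corners have cosine at
least `cos α`, with equality for vertex and face centre, and this passes to nonnegative combinations
(`inner_ge_of_mem_kite`). The group `I^h` contains `I`, so its diameter is no larger. -/

/-! ### The constant `cos α`, and the diameter in terms of inner products -/

/-- The cosine of `alphaAngle`. -/
noncomputable def alphaCos : ℝ := Real.tan (3 * Real.pi / 10) / Real.sqrt 3

theorem sqrt_five_sq : (√5 : ℝ) ^ 2 = 5 := Real.sq_sqrt (by norm_num)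

theorem alphaCos_sq : alphaCos ^ 2 = (1 + 2 / √5) / 3 := by
  have h5 := sqrt_five_sq
  have h50 : (0 : ℝ) < √5 := by positivity
  have hs : Real.sin (3 * Real.pi / 10) = Real.cos (Real.pi / 5) := by
    rw [← Real.cos_pi_div_two_sub]; congr 1; ring
  have hc : Real.cos (3 * Real.pi / 10) ^ 2 = 1 - Real.cos (Real.pi / 5) ^ 2 := by
    rw [Real.cos_sq', hs]
  have hlt : √5 < 3 := by nlinarith
  rw [alphaCos, Real.tan_eq_sin_div_cos, div_pow, div_pow, hc, hs, Real.cos_pi_div_five,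
    Real.sq_sqrt (by norm_num)]
  congr 1
  have : (1 - ((1 + √5) / 4) ^ 2) ≠ 0 := by nlinarith
  have h16 : (16 - (1 + √5) ^ 2 : ℝ) ≠ 0 := by nlinarith
  have hne : (√5 : ℝ) ≠ 0 := h50.ne'
  field_simp
  rw [div_eq_iff (by norm_num; exact h16)]
  nlinarith

theorem alphaCos_nonneg : 0 ≤ alphaCos := by
  have hpi := Real.pi_pos
  refine div_nonneg (Real.tan_nonneg_of_nonneg_of_le_pi_div_two ?_ ?_) (Real.sqrt_nonneg _) <;>
    linarith

/-- The coarse bound `3/5 ≤ cos² α` serves every finite case except the face centre of the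
icosahedron. -/
theorem three_fifths_lt : (3 : ℝ) / 5 ≤ (1 + 2 / √5) / 3 := by
  have h5 := sqrt_five_sq
  have h50 : (0 : ℝ) < √5 := by positivity
  have : (4 : ℝ) / 5 ≤ 2 / √5 := by
    rw [div_le_div_iff₀ (by norm_num) h50]; nlinarith
  linarith

theorem sphereDist_eq_arccos (x y : S2) :
    sphereDist x y = Real.arccos (inner ℝ (x : E3) (y : E3)) := by
  have hx : ‖(x : E3)‖ = 1 := mem_sphere_zero_iff_norm.1 x.2
  have hy : ‖(y : E3)‖ = 1 := mem_sphere_zero_iff_norm.1 y.2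
  simp [sphereDist, InnerProductGeometry.angle, hx, hy]

theorem orbitDist_le_pi (G : Subgroup O3) (a b : OrbitSpace G) : orbitDist G a b ≤ Real.pi := by
  obtain ⟨x, rfl⟩ := orbitMk_surjective G a
  obtain ⟨y, rfl⟩ := orbitMk_surjective G b
  exact (orbitDist_le G x y).trans (InnerProductGeometry.angle_le_pi _ _)

theorem inner_smul_left_eq (g : O3) (x y : E3) :
    inner ℝ (g • x) y = inner ℝ x (g⁻¹ • y) := by
  rw [← O3.inner_smul_smul g⁻¹ (g • x), inv_smul_smul]

/-- A pair of orbits all of whose mutual inner products are at most `cos α` bounds the diameter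
from below. -/
theorem alphaAngle_le_diam {G : Subgroup O3} {x w : S2}
    (h : ∀ g ∈ G, inner ℝ (g • (x : E3)) (w : E3) ≤ alphaCos) :
    alphaAngle ≤ orbitSpaceDiam G := by
  -- Boundedness is needed because `Metric.diam` of an unbounded set is 0 by convention.
  have hb : Bornology.IsBounded (Set.univ : Set (OrbitSpace G)) :=
    Metric.isBounded_iff.2 ⟨Real.pi, fun a _ b _ => orbitDist_le_pi G a b⟩
  refine le_trans ?_ (Metric.dist_le_diam_of_mem hb (Set.mem_univ (orbitMk G x))
    (Set.mem_univ (orbitMk G w)))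
  refine le_csInf (orbitDistSet_nonempty G _ _) ?_
  rintro _ ⟨y, z, hy, hz, rfl⟩
  obtain ⟨g, hg, rfl⟩ := (orbitMk_eq_iff G _ _).1 hy
  obtain ⟨k, hk, rfl⟩ := (orbitMk_eq_iff G _ _).1 hz
  rw [sphereDist_eq_arccos]
  refine Real.arccos_le_arccos ?_
  have := h (k⁻¹ * g) (mul_mem (inv_mem hk) hg)
  rw [mul_smul, inner_smul_left_eq, inv_inv] at this
  exact this

theorem orbitSpaceDiam_le {G : Subgroup O3}
    (h : ∀ x y : S2, ∃ g ∈ G, alphaCos ≤ inner ℝ (g • (x : E3)) (y : E3)) :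
    orbitSpaceDiam G ≤ alphaAngle := by
  refine Metric.diam_le_of_forall_dist_le (Real.arccos_nonneg _) ?_
  intro a _ b _
  obtain ⟨x, rfl⟩ := orbitMk_surjective G a
  obtain ⟨y, rfl⟩ := orbitMk_surjective G b
  obtain ⟨g, hg, hxy⟩ := h x y
  have hx : orbitMk G (g • x) = orbitMk G x := (orbitMk_eq_iff G _ _).2 ⟨g, hg, rfl⟩
  rw [← hx]
  refine (orbitDist_le G _ _).trans ?_
  rw [sphereDist_eq_arccos]
  exact Real.arccos_le_arccos hxy

/-! ### Vectors, cross products and rotations -/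

theorem S2.norm_coe (x : S2) : ‖(x : E3)‖ = 1 := mem_sphere_zero_iff_norm.1 x.2

theorem S2.inner_self (x : S2) : inner ℝ (x : E3) (x : E3) = 1 := by
  rw [real_inner_self_eq_norm_sq, S2.norm_coe, one_pow]

/-- The direction of a nonzero vector. -/
noncomputable def S2.normalize (v : E3) (hv : v ≠ 0) : S2 :=
  ⟨‖v‖⁻¹ • v, by
    rw [mem_sphere_zero_iff_norm, norm_smul, norm_inv, norm_norm,
      inv_mul_cancel₀ (norm_ne_zero_iff.2 hv)]⟩

theorem S2.inner_normalize (x v : E3) (hv : v ≠ 0) :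
    inner ℝ x (S2.normalize v hv : E3) = inner ℝ x v / ‖v‖ := by
  rw [S2.normalize, inner_smul_right, div_eq_inv_mul]

theorem inner_eq_dot (x y : E3) : inner ℝ x y = x.ofLp ⬝ᵥ y.ofLp := by
  rw [EuclideanSpace.inner_eq_star_dotProduct, star_trivial, dotProduct_comm]

/-- The cross product on Euclidean three-space. -/
noncomputable def cross3 (x y : E3) : E3 := WithLp.toLp 2 (crossProduct x.ofLp y.ofLp)

theorem inner_cross3 (x y z : E3) :
    inner ℝ x (cross3 y z) = (Matrix.of ![x.ofLp, y.ofLp, z.ofLp]).det := by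
  rw [inner_eq_dot]; exact triple_product_eq_det _ _ _

theorem cross3_inner_cross3 (x y : E3) : inner ℝ (cross3 x y) (cross3 x y) =
    inner ℝ x x * inner ℝ y y - inner ℝ x y ^ 2 := by
  simp only [inner_eq_dot, cross3]
  rw [cross_dot_cross, dotProduct_comm y.ofLp x.ofLp, sq]

theorem O3.inner_cross3_smul (A : O3) (x y z : E3) :
    inner ℝ (A • x) (cross3 (A • y) (A • z)) = A.1.det * inner ℝ x (cross3 y z) := by
  rw [inner_cross3, inner_cross3]
  have : Matrix.of ![(A • x).ofLp, (A • y).ofLp, (A • z).ofLp] =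
      Matrix.of ![x.ofLp, y.ofLp, z.ofLp] * A.1.transpose := by
    ext i j
    fin_cases i <;>
    simp [O3.smul_def, Matrix.mulVec, Matrix.mul_apply, dotProduct, mul_comm]
  rw [this]
  rw [Matrix.det_mul, Matrix.det_transpose, mul_comm]

theorem O3.cross3_smul (A : O3) (y z : E3) :
    cross3 (A • y) (A • z) = A.1.det • (A • cross3 y z) := by
  refine ext_inner_left ℝ fun v => ?_
  rw [inner_smul_right]
  have h := O3.inner_cross3_smul A (A⁻¹ • v) y z
  rw [smul_inv_smul] at h
  rw [h, inner_smul_left_eq, inv_inv]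

theorem S2.eq_or_eq_neg_of_inner_sq {x y : S2} (h : inner ℝ (x : E3) (y : E3) ^ 2 = 1) :
    x = y ∨ x = -y := by
  rcases (sq_eq_sq_iff_eq_or_eq_neg.1 (h.trans (one_pow 2).symm)) with h | h
  · left
    exact Subtype.ext ((inner_eq_one_iff_of_norm_eq_one x.norm_coe y.norm_coe).1 h)
  · right
    refine Subtype.ext ((inner_eq_one_iff_of_norm_eq_one (𝕜 := ℝ) x.norm_coe (-y).norm_coe).1 ?_)
    rw [coe_neg_sphere, inner_neg_right, h, neg_neg]

theorem S2.cross3_ne_zero {x y : S2} (h : x ≠ y) (h' : x ≠ -y) : cross3 (x : E3) y ≠ 0 := by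
  intro h0
  have := cross3_inner_cross3 (x : E3) y
  rw [h0, inner_zero_left, S2.inner_self, S2.inner_self] at this
  rcases S2.eq_or_eq_neg_of_inner_sq (x := x) (y := y) (by linarith) with h1 | h1
  exacts [h h1, h' h1]

theorem S2.abs_inner_lt_one {x y : S2} (h : x ≠ y) (h' : x ≠ -y) :
    |inner ℝ (x : E3) (y : E3)| < 1 := by
  have h1 : |inner ℝ (x : E3) (y : E3)| ≤ 1 := by
    simpa [S2.norm_coe] using abs_real_inner_le_norm (x : E3) y
  refine lt_of_le_of_ne h1 fun h2 => ?_
  rcases S2.eq_or_eq_neg_of_inner_sq (x := x) (y := y) (by rw [← sq_abs, h2, one_pow]) with h3 | h3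
  exacts [h h3, h' h3]

theorem exists_S2_perp (x y : S2) :
    ∃ w : S2, inner ℝ (x : E3) (w : E3) = 0 ∧ inner ℝ (y : E3) (w : E3) = 0 := by
  have key : ∃ v : E3, v ≠ 0 ∧ inner ℝ (x : E3) v = 0 ∧ inner ℝ (y : E3) v = 0 := by
    -- The zero third row makes the matrix singular; a kernel vector is orthogonal to the other two
    -- rows.
    obtain ⟨v, hv, h⟩ := Matrix.exists_mulVec_eq_zero_iff.2
      (show (Matrix.of ![x.1.ofLp, y.1.ofLp, 0]).det = 0 from
        Matrix.det_eq_zero_of_row_eq_zero 2 fun j => rfl)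
    refine ⟨WithLp.toLp 2 v, fun h0 => hv ?_, ?_, ?_⟩
    · simpa using h0
    · rw [inner_eq_dot]; exact congrFun h 0
    · rw [inner_eq_dot]; exact congrFun h 1
  obtain ⟨v, hv, h1, h2⟩ := key
  exact ⟨S2.normalize v hv, by rw [S2.inner_normalize, h1, zero_div],
    by rw [S2.inner_normalize, h2, zero_div]⟩

theorem O3.smul_neg_S2 (A : O3) (x : S2) : A • (-x) = -(A • x) :=
  Subtype.ext (smul_neg A (x : E3))

theorem O3.ext_smul {A B : O3} (h : ∀ x : E3, A • x = B • x) : A = B := by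
  refine Subtype.ext (Matrix.toLin'.injective (LinearMap.ext fun v => ?_))
  simpa [O3.smul_def] using congrArg WithLp.ofLp (h (WithLp.toLp 2 v))

/-- From `A - 1 = A (1 - A)ᵀ` and `det A = 1`, `det (A - 1) = det (1 - A)`; in odd dimension this
equals `-det (A - 1)`, so 1 is an eigenvalue. -/
theorem O3.exists_fixed {A : O3} (hA : A.1.det = 1) : ∃ p : S2, A • p = p := by
  have h0 : (A.1 - 1).det = 0 := by
    have h1 : A.1 * A.1.transpose = 1 := (Matrix.mem_orthogonalGroup_iff (Fin 3) ℝ).1 A.2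
    have h2 : A.1 - 1 = A.1 * (1 - A.1).transpose := by
      rw [Matrix.transpose_sub, Matrix.transpose_one, mul_sub, h1, mul_one]
    have h3 : (A.1 - 1).det = (1 - A.1).det := by
      rw [h2, Matrix.det_mul, hA, one_mul, Matrix.det_transpose]
    have h4 : (1 - A.1).det = -(A.1 - 1).det := by
      rw [← neg_sub, Matrix.det_neg]; norm_num
    linarith
  obtain ⟨v, hv, h⟩ := Matrix.exists_mulVec_eq_zero_iff.2 h0
  have hv' : WithLp.toLp 2 v ≠ 0 := fun h0 => hv (by simpa using h0)
  have hAv : A • (WithLp.toLp 2 v : E3) = WithLp.toLp 2 v := by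
    rw [Matrix.sub_mulVec, Matrix.one_mulVec, sub_eq_zero] at h
    rw [O3.smul_def, h]
  refine ⟨S2.normalize _ hv', Subtype.ext ?_⟩
  rw [O3.coe_smul, S2.normalize]
  exact (smul_comm A _ _).trans (by rw [hAv])

/-- Since `det A = 1`, `A` also fixes `q × p`, so it fixes a basis. Each `A x - x` is orthogonal to
all fixed vectors, hence zero. -/
theorem O3.eq_one_of_fixed {A : O3} (hA : A.1.det = 1) {p q : S2} (hp : A • p = p)
    (hq : A • q = q) (h : q ≠ p) (h' : q ≠ -p) : A = 1 := by
  have hp' : A • (p : E3) = p := congrArg Subtype.val hp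
  have hq' : A • (q : E3) = q := congrArg Subtype.val hq
  set c := cross3 (q : E3) p with hc
  have hc0 : c ≠ 0 := S2.cross3_ne_zero h h'
  have hcc : A • c = c := by
    have := O3.cross3_smul A q p
    rw [hp', hq', hA, one_smul] at this
    exact this.symm
  have hdet : (Matrix.of ![c.ofLp, q.1.ofLp, p.1.ofLp]).det ≠ 0 := by
    rw [← inner_cross3]
    exact inner_self_ne_zero.2 hc0
  refine O3.ext_smul fun x => ?_
  rw [one_smul]
  by_contra hx
  refine hdet (Matrix.exists_mulVec_eq_zero_iff.1 ⟨(A • x - x).ofLp, ?_, ?_⟩)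
  · intro h0
    apply hx
    rw [← sub_eq_zero]
    ext i
    exact congrFun h0 i
  · have key : ∀ v : E3, A • v = v → v.ofLp ⬝ᵥ (A • x - x).ofLp = 0 := by
      intro v hv
      rw [← inner_eq_dot, inner_sub_right]
      nth_rewrite 1 [← hv]
      rw [O3.inner_smul_smul, sub_self]
    funext i
    fin_cases i
    · exact key c hcc
    · exact key q hq'
    · exact key p hp'

/-! ### Compactness, infinitesimal rotations and infinite groups -/

open Filter Topology in
instance O3.compactSpace : CompactSpace O3 := by
  have hset : ((Matrix.orthogonalGroup (Fin 3) ℝ : Submonoid _) : Set (Matrix (Fin 3) (Fin 3) ℝ)) =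
      {M | M * M.transpose = 1} := by
    ext M; exact Matrix.mem_orthogonalGroup_iff (Fin 3) ℝ
  have hcl : IsClosed {M : Matrix (Fin 3) (Fin 3) ℝ | M * M.transpose = 1} :=
    isClosed_eq (by fun_prop) continuous_const
  have hK : IsCompact (Set.univ.pi fun _ : Fin 3 => Set.univ.pi fun _ : Fin 3 =>
      Set.Icc (-1 : ℝ) 1) :=
    isCompact_univ_pi fun _ => isCompact_univ_pi fun _ => isCompact_Icc
  refine isCompact_iff_compactSpace.1 (?_ : IsCompact
    ((Matrix.orthogonalGroup (Fin 3) ℝ : Submonoid _) : Set (Matrix (Fin 3) (Fin 3) ℝ)))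
  refine IsCompact.of_isClosed_subset hK (hset ▸ hcl) ?_
  intro M hM i _ j _
  have := entry_norm_bound_of_unitary hM i j
  exact abs_le.1 this

theorem O3.continuous_inner_smul (x y : E3) : Continuous fun g : O3 => inner ℝ (g • x) y := by
  simp only [inner_eq_dot, O3.smul_def]
  refine Continuous.dotProduct ?_ continuous_const
  exact Continuous.matrix_mulVec continuous_subtype_val continuous_const

/-- A skew-symmetric matrix acts as the cross product with its axial vector. -/
theorem exists_axial {B : Matrix (Fin 3) (Fin 3) ℝ} (hB : B.transpose = -B) (h0 : B ≠ 0) :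
    ∃ ω : E3, ω ≠ 0 ∧ ∀ a b : E3, (B.mulVec a.ofLp) ⬝ᵥ b.ofLp = inner ℝ ω (cross3 a b) := by
  have h : ∀ i j, B j i = -B i j := fun i j => congrFun (congrFun hB i) j
  have h00 : B 0 0 = 0 := by linarith [h 0 0]
  have h11 : B 1 1 = 0 := by linarith [h 1 1]
  have h22 : B 2 2 = 0 := by linarith [h 2 2]
  have h01 := h 0 1
  have h02 := h 2 0
  have h12 := h 1 2
  refine ⟨!₂[B 2 1, B 0 2, B 1 0], fun hω => h0 ?_, fun a b => ?_⟩
  · have e0 : B 2 1 = 0 := congrFun (congrArg WithLp.ofLp hω) 0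
    have e1 : B 0 2 = 0 := congrFun (congrArg WithLp.ofLp hω) 1
    have e2 : B 1 0 = 0 := congrFun (congrArg WithLp.ofLp hω) 2
    ext i j
    fin_cases i <;> fin_cases j <;> simp <;> linarith
  · rw [inner_eq_dot]
    simp only [cross3, cross_apply, Matrix.mulVec, dotProduct, Fin.sum_univ_three,
      Matrix.cons_val_zero, Matrix.cons_val_one, Matrix.cons_val, h00, h11, h22]
    have k1 : B 0 1 = - B 1 0 := by linarith
    have k2 : B 2 0 = - B 0 2 := by linarith
    have k3 : B 1 2 = - B 2 1 := by linarith
    rw [k1, k2, k3]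
    ring

section InfiniteGroup

open Filter Topology

/-- An infinite subset of a compact set accumulates at some `a` in it; left translation by `a⁻¹`
moves the accumulation point to 1. -/
theorem O3.exists_ultrafilter_of_infinite {G : Subgroup O3} (hG : IsClosed (G : Set O3))
    (hinf : (G : Set O3).Infinite) :
    ∃ U : Ultrafilter O3, (U : Filter O3) ≤ 𝓝 1 ∧ ∀ᶠ g in (U : Filter O3), g ∈ G ∧ g ≠ 1 := by
  obtain ⟨a, ha, hacc⟩ := hinf.exists_accPt_of_subset_isCompact hG.isCompact subset_rfl
  have : NeBot (𝓝[≠] a ⊓ 𝓟 (G : Set O3)) := hacc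
  set U := (Ultrafilter.of (𝓝[≠] a ⊓ 𝓟 (G : Set O3))).map (fun g => a⁻¹ * g)
  have hle := Ultrafilter.of_le (𝓝[≠] a ⊓ 𝓟 (G : Set O3))
  refine ⟨U, ?_, ?_⟩
  · have h1 : Tendsto (fun g : O3 => a⁻¹ * g) (𝓝 a) (𝓝 1) := by
      have : Continuous fun g : O3 => a⁻¹ * g := by fun_prop
      simpa using this.tendsto a
    exact h1.mono_left (hle.trans (inf_le_left.trans nhdsWithin_le_nhds))
  · change ∀ᶠ g in ((Ultrafilter.of _ : Ultrafilter O3) : Filter O3),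
      a⁻¹ * g ∈ G ∧ a⁻¹ * g ≠ 1
    have h1 : ∀ᶠ g in 𝓝[≠] a ⊓ 𝓟 (G : Set O3), g ≠ a ∧ g ∈ G :=
      ((eventually_mem_nhdsWithin (s := {a}ᶜ)).filter_mono inf_le_left).and
        ((mem_inf_of_right (mem_principal_self _) : _ ∈ _))
    filter_upwards [hle h1] with g hg
    exact ⟨mul_mem (inv_mem ha) hg.2, fun h => hg.1 (by rw [inv_mul_eq_one] at h; exact h.symm)⟩

/-- An infinite closed subgroup of `O(3)` has a nonzero infinitesimal rotation as a limit of
rescaled elements. -/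
theorem O3.exists_infinitesimal_rotation {G : Subgroup O3} (hG : IsClosed (G : Set O3))
    (hinf : (G : Set O3).Infinite) :
    ∃ ω : E3, ω ≠ 0 ∧ ∃ U : Ultrafilter O3, ∃ d : O3 → ℝ,
      (∀ᶠ g in (U : Filter O3), g ∈ G ∧ 0 < d g) ∧
      ∀ a b : E3, Tendsto (fun g : O3 => (d g)⁻¹ * (inner ℝ (g • a) b - inner ℝ a b)) U
        (𝓝 (inner ℝ ω (cross3 a b))) := by
  obtain ⟨U, hU, hUG⟩ := O3.exists_ultrafilter_of_infinite hG hinf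
  -- `q` is the squared Frobenius norm of `g - 1`. The rescaled matrices `b g` below have Frobenius
  -- norm 1, so they stay in a compact set and their limit is nonzero.
  set q : O3 → ℝ := fun g => ∑ i, ∑ j, (g.1 - 1) i j ^ 2 with hq
  set d : O3 → ℝ := fun g => √(q g) with hd
  have hq0 : ∀ g, 0 ≤ q g := fun g => Finset.sum_nonneg fun i _ =>
    Finset.sum_nonneg fun j _ => sq_nonneg _
  have hd0 : ∀ g : O3, g ≠ 1 → 0 < d g := by
    intro g hg
    refine Real.sqrt_pos.2 (lt_of_le_of_ne (hq0 g) fun h => hg ?_)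
    have h1 := (Finset.sum_eq_zero_iff_of_nonneg (fun i _ =>
      Finset.sum_nonneg fun j _ => sq_nonneg ((g.1 - 1) i j))).1 h.symm
    refine Subtype.ext (sub_eq_zero.1 ?_)
    ext i j
    exact pow_eq_zero_iff two_ne_zero |>.1 ((Finset.sum_eq_zero_iff_of_nonneg
      (fun j _ => sq_nonneg ((g.1 - 1) i j))).1 (h1 i (Finset.mem_univ i)) j (Finset.mem_univ j))
  have hdc : Tendsto d U (𝓝 0) := by
    have hc : Continuous d := by
      refine Real.continuous_sqrt.comp (continuous_finsetSum _ fun i _ =>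
        continuous_finsetSum _ fun j _ => ?_)
      have : Continuous fun g : O3 => (g.1 - 1) := by fun_prop
      exact (this.matrix_elem i j).pow 2
    have h1 : d 1 = 0 := by simp [hd, hq]
    exact h1 ▸ (hc.tendsto 1).mono_left hU
  set b : O3 → Matrix (Fin 3) (Fin 3) ℝ := fun g => (d g)⁻¹ • (g.1 - 1) with hb
  have hK : IsCompact (Set.univ.pi fun _ : Fin 3 => Set.univ.pi fun _ : Fin 3 =>
      Set.Icc (-1 : ℝ) 1) :=
    isCompact_univ_pi fun _ => isCompact_univ_pi fun _ => isCompact_Icc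
  have hbsum : ∀ g : O3, g ≠ 1 → ∑ i, ∑ j, b g i j ^ 2 = 1 := by
    intro g hg
    have h1 : ∀ i j, b g i j ^ 2 = (d g ^ 2)⁻¹ * (g.1 - 1) i j ^ 2 := fun i j => by
      simp only [hb, Matrix.smul_apply, smul_eq_mul, mul_pow, inv_pow]
    simp only [h1, ← Finset.mul_sum]
    rw [show d g ^ 2 = q g from Real.sq_sqrt (hq0 g)]
    refine inv_mul_cancel₀ ?_
    have := hd0 g hg
    exact (Real.sqrt_pos.1 this).ne'
  have hbK : ∀ᶠ g in (U : Filter O3), b g ∈ (Set.univ.pi fun _ : Fin 3 =>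
      Set.univ.pi fun _ : Fin 3 => Set.Icc (-1 : ℝ) 1) := by
    filter_upwards [hUG] with g hg i _ j _
    rw [Set.mem_Icc, ← abs_le, ← sq_le_one_iff_abs_le_one, ← hbsum g hg.2]
    exact (Finset.single_le_sum (f := fun j => b g i j ^ 2) (fun j _ => sq_nonneg _)
      (Finset.mem_univ j)).trans (Finset.single_le_sum (f := fun i => ∑ j, b g i j ^ 2)
        (fun i _ => Finset.sum_nonneg fun j _ => sq_nonneg _) (Finset.mem_univ i))
  obtain ⟨(B : Matrix (Fin 3) (Fin 3) ℝ), -, hB⟩ := hK.ultrafilter_le_nhds (U.map b) (le_principal_iff.2 hbK)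
  replace hB : Tendsto b U (𝓝 B) := hB
  have hB0 : B ≠ 0 := by
    have h1 : Tendsto (fun g => ∑ i, ∑ j, b g i j ^ 2) U (𝓝 (∑ i, ∑ j, B i j ^ 2)) :=
      tendsto_finsetSum _ fun i _ => tendsto_finsetSum _ fun j _ =>
        (((continuous_id.matrix_elem i j).tendsto B).comp hB).pow 2
    have h2 : Tendsto (fun g => ∑ i, ∑ j, b g i j ^ 2) U (𝓝 1) :=
      tendsto_const_nhds.congr' (by
        filter_upwards [hUG] with g hg using (hbsum g hg.2).symm)
    intro h0
    have := tendsto_nhds_unique h1 h2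
    simp [h0] at this
  -- Orthogonality of `g` reads `bᵀ + b = -d • (b bᵀ)`, and `d` tends to 0 in the limit.
  have hskew : B.transpose = -B := by
    have h1 : Tendsto (fun g => (b g).transpose + b g) U (𝓝 (B.transpose + B)) :=
      ((continuous_id.matrix_transpose.tendsto B).comp hB).add hB
    have h2 : Tendsto (fun g => -(d g • (b g * (b g).transpose))) U
        (𝓝 (-((0 : ℝ) • (B * B.transpose)))) :=
      (hdc.smul (hB.mul ((continuous_id.matrix_transpose.tendsto B).comp hB))).neg
    have h3 : (fun g => (b g).transpose + b g) =ᶠ[(U : Filter O3)]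
        fun g => -(d g • (b g * (b g).transpose)) := by
      filter_upwards [hUG] with g hg
      have hg1 : g.1 * g.1.transpose = 1 := (Matrix.mem_orthogonalGroup_iff (Fin 3) ℝ).1 g.2
      have hg2 : (g.1 - 1) * (g.1 - 1).transpose = -((g.1 - 1).transpose + (g.1 - 1)) := by
        rw [Matrix.transpose_sub, Matrix.transpose_one, mul_sub, sub_mul, sub_mul, hg1]
        simp only [mul_one, one_mul]
        abel
      simp only [hb, Matrix.transpose_smul, Matrix.smul_mul, Matrix.mul_smul, hg2, smul_neg,
        neg_neg]
      rw [smul_smul, mul_inv_cancel₀ (hd0 g hg.2).ne', one_smul, smul_add]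
    have := tendsto_nhds_unique h1 (h2.congr' h3.symm)
    rw [zero_smul, neg_zero] at this
    exact eq_neg_of_add_eq_zero_left this
  obtain ⟨ω, hω, hωB⟩ := exists_axial hskew hB0
  refine ⟨ω, hω, U, d, ?_, fun x y => ?_⟩
  · filter_upwards [hUG] with g hg using ⟨hg.1, hd0 g hg.2⟩
  · rw [← hωB]
    have hc : Continuous fun M : Matrix (Fin 3) (Fin 3) ℝ => M.mulVec x.ofLp ⬝ᵥ y.ofLp :=
      (continuous_id.matrix_mulVec continuous_const).dotProduct continuous_const
    refine ((hc.tendsto B).comp hB).congr fun g => ?_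
    simp only [Function.comp, hb, Matrix.smul_mulVec, Matrix.sub_mulVec, Matrix.one_mulVec,
      smul_dotProduct, sub_dotProduct, smul_eq_mul, inner_eq_dot, O3.smul_def]

theorem alphaAngle_le_diam_of_infinite {G : Subgroup O3} (hG : IsClosed (G : Set O3))
    (hinf : (G : Set O3).Infinite) (hnt : ¬ MulAction.IsPretransitive G S2) :
    alphaAngle ≤ orbitSpaceDiam G := by
  obtain ⟨ω, hω, U, d, hUG, hlim⟩ := O3.exists_infinitesimal_rotation hG hinf
  have : ∃ x w : S2, ∀ g ∈ G, g • x ≠ w := by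
    by_contra! h
    exact hnt ⟨fun x y => let ⟨g, hg, h⟩ := h x y; ⟨⟨g, hg⟩, h⟩⟩
  obtain ⟨x, w, hxw⟩ := this
  obtain ⟨k, hk, hmax⟩ := hG.isCompact.exists_isMaxOn ⟨1, one_mem G⟩
    (O3.continuous_inner_smul (x : E3) (w : E3)).continuousOn
  set y : S2 := k • x with hy
  have hmax' : ∀ g ∈ G, inner ℝ (g • (y : E3)) (w : E3) ≤ inner ℝ (y : E3) (w : E3) := by
    intro g hg
    have := hmax (mul_mem hg hk)
    simpa [mul_smul, hy, O3.coe_smul] using this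
  -- Maximality makes the derivative `⟪ω, a × b⟫` nonpositive at `a = h⁻¹ y`, `b = h⁻¹ w`.
  -- Exchanging `a` and `b`, with `g⁻¹` in place of `g`, reverses the sign.
  have horth : ∀ h ∈ G, inner ℝ ω (h⁻¹ • cross3 (y : E3) w) = 0 := by
    intro h hh
    have hle : ∀ a b : E3, (∀ g ∈ G, inner ℝ (g • a) b ≤ inner ℝ a b) →
        inner ℝ ω (cross3 a b) ≤ 0 := by
      intro a b hab
      refine le_of_tendsto (hlim a b) ?_
      filter_upwards [hUG] with g hg
      exact mul_nonpos_of_nonneg_of_nonpos (inv_nonneg.2 hg.2.le) (by linarith [hab g hg.1])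
    have h1 : ∀ g ∈ G, inner ℝ (g • (h⁻¹ • (y : E3))) (h⁻¹ • (w : E3)) ≤
        inner ℝ (h⁻¹ • (y : E3)) (h⁻¹ • (w : E3)) := by
      intro g hg
      rw [O3.inner_smul_smul, ← inner_smul_left_eq, ← mul_smul, ← mul_smul]
      exact hmax' _ (mul_mem (mul_mem hh hg) (inv_mem hh))
    have h2 := hle _ _ h1
    have h3 := hle (h⁻¹ • (w : E3)) (h⁻¹ • (y : E3)) fun g hg => by
      rw [real_inner_comm, ← inv_inv g, ← inner_smul_left_eq,
        real_inner_comm (h⁻¹ • (y : E3))]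
      exact h1 _ (inv_mem hg)
    have h4 : cross3 (h⁻¹ • (w : E3)) (h⁻¹ • (y : E3)) =
        -cross3 (h⁻¹ • (y : E3)) (h⁻¹ • (w : E3)) := by
      refine PiLp.ext fun i => ?_
      exact congrFun (cross_anticomm (h⁻¹ • (y : E3)).ofLp (h⁻¹ • (w : E3)).ofLp).symm i
    rw [h4, inner_neg_right] at h3
    have h5 : inner ℝ ω (cross3 (h⁻¹ • (y : E3)) (h⁻¹ • (w : E3))) = 0 := by linarith
    rw [O3.cross3_smul, inner_smul_right] at h5
    refine (mul_eq_zero.1 h5).resolve_left fun h0 => ?_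
    have := (Matrix.mem_orthogonalGroup_iff (Fin 3) ℝ).1 (h⁻¹).2
    have := congrArg Matrix.det this
    rw [Matrix.det_mul, h0, zero_mul, Matrix.det_one] at this
    exact zero_ne_one this
  have hyw : y ≠ w := hxw k hk
  by_cases hyw' : y = -w
  -- Here even the maximum of `⟪g y, w⟫` is -1, so `G` fixes `w`, and any point orthogonal to `w`
  -- will do.
  · obtain ⟨v, hv, -⟩ := exists_S2_perp w w
    refine alphaAngle_le_diam (x := w) (w := v) fun g hg => ?_
    suffices h : g • w = w by
      have : g • (w : E3) = w := congrArg Subtype.val h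
      rw [this, hv]
      exact alphaCos_nonneg
    have h1 := hmax' g hg
    have h2 : inner ℝ (g • (w : E3)) (w : E3) = 1 := by
      refine le_antisymm ?_ ?_
      · simpa [O3.norm_smul_eq, S2.norm_coe] using real_inner_le_norm (g • (w : E3)) w
      · rw [hyw', coe_neg_sphere, smul_neg, inner_neg_left, inner_neg_left, S2.inner_self] at h1
        linarith
    exact Subtype.ext ((inner_eq_one_iff_of_norm_eq_one (𝕜 := ℝ) (g • w).norm_coe w.norm_coe).1 h2)
  · refine alphaAngle_le_diam (x := S2.normalize _ (S2.cross3_ne_zero hyw hyw'))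
      (w := S2.normalize ω hω) fun g hg => ?_
    have := horth g⁻¹ (inv_mem hg)
    rw [inv_inv] at this
    rw [S2.inner_normalize, inner_smul_left_eq, real_inner_comm, S2.inner_normalize,
      inner_smul_left_eq, inv_inv, this, zero_div, zero_div]
    exact alphaCos_nonneg

end InfiniteGroup

/-! ### The icosahedral group and the upper bound -/

theorem alphaCos_sq_eq : alphaCos ^ 2 = (4 * φ + 3) / 15 := by
  have h5 := sqrt_five_sq
  have h50 : (0 : ℝ) < √5 := by positivity
  rw [alphaCos_sq, Real.goldenRatio]
  field_simp
  nlinarith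

theorem goldenRatio_bounds : 1.6 < φ ∧ φ < 1.62 := by
  have h := Real.goldenRatio_sq
  have h0 := Real.goldenRatio_pos
  constructor <;> nlinarith

theorem mem_icosahedronVertices_0 {v : E3} {s t : ℝ} (hs : s = 1 ∨ s = -1) (ht : t = 1 ∨ t = -1)
    (h0 : v 0 = 0) (h1 : v 1 = s) (h2 : v 2 = t * φ) : v ∈ icosahedronVertices :=
  ⟨s, t, hs, ht, Or.inl (by ext i; fin_cases i <;> simpa)⟩

theorem mem_icosahedronVertices_1 {v : E3} {s t : ℝ} (hs : s = 1 ∨ s = -1) (ht : t = 1 ∨ t = -1)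
    (h0 : v 0 = s) (h1 : v 1 = t * φ) (h2 : v 2 = 0) : v ∈ icosahedronVertices :=
  ⟨s, t, hs, ht, Or.inr (Or.inl (by ext i; fin_cases i <;> simpa))⟩

theorem mem_icosahedronVertices_2 {v : E3} {s t : ℝ} (hs : s = 1 ∨ s = -1) (ht : t = 1 ∨ t = -1)
    (h0 : v 0 = t * φ) (h1 : v 1 = 0) (h2 : v 2 = s) : v ∈ icosahedronVertices :=
  ⟨s, t, hs, ht, Or.inr (Or.inr (by ext i; fin_cases i <;> simpa))⟩

theorem icosahedronVertices_finite : icosahedronVertices.Finite := by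
  have hS : (({1, -1} : Set ℝ) ×ˢ ({1, -1} : Set ℝ)).Finite :=
    (Set.toFinite _).prod (Set.toFinite _)
  refine (((hS.image fun p => (!₂[0, p.1, p.2 * φ] : E3)).union
    (hS.image fun p => (!₂[p.1, p.2 * φ, 0] : E3))).union
    (hS.image fun p => (!₂[p.2 * φ, 0, p.1] : E3))).subset ?_
  rintro v ⟨s, t, hs, ht, h | h | h⟩
  · exact Or.inl (Or.inl ⟨(s, t), ⟨hs, ht⟩, h.symm⟩)
  · exact Or.inl (Or.inr ⟨(s, t), ⟨hs, ht⟩, h.symm⟩)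
  · exact Or.inr ⟨(s, t), ⟨hs, ht⟩, h.symm⟩

theorem mem_fullIcosahedralGroup {g : O3} :
    g ∈ fullIcosahedralGroup ↔ ∀ v ∈ icosahedronVertices, g • v ∈ icosahedronVertices := by
  rw [fullIcosahedralGroup,
    MulAction.mem_stabilizer_set_iff_smul_set_subset icosahedronVertices_finite]
  exact Set.image_subset_iff

theorem O3.continuous_smul_const (x : E3) : Continuous fun g : O3 => g • x := by
  simp only [O3.smul_def]
  exact (PiLp.continuous_toLp 2 _).comp
    (Continuous.matrix_mulVec continuous_subtype_val continuous_const)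

theorem isClosed_fullIcosahedralGroup : IsClosed (fullIcosahedralGroup : Set O3) := by
  have : (fullIcosahedralGroup : Set O3) =
      ⋂ v ∈ icosahedronVertices, (fun g : O3 => g • v) ⁻¹' icosahedronVertices := by
    ext g; simp [mem_fullIcosahedralGroup]
  rw [this]
  exact isClosed_biInter fun v _ =>
    icosahedronVertices_finite.isClosed.preimage (O3.continuous_smul_const v)

theorem icosahedralGroup_le : icosahedralGroup ≤ fullIcosahedralGroup := fun _ h => h.1

theorem isClosed_icosahedralGroup : IsClosed (icosahedralGroup : Set O3) :=
  isClosed_fullIcosahedralGroup.inter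
    (isClosed_eq (continuous_subtype_val.matrix_det) continuous_const)

/-- No symmetry carries the direction of a vertex to that of `(1, 0, 0)`, because no vertex is a
multiple of `(1, 0, 0)`. -/
theorem not_isPretransitive_of_le_fullIcosahedralGroup {G : Subgroup O3}
    (hG : G ≤ fullIcosahedralGroup) : ¬ MulAction.IsPretransitive G S2 := by
  intro h
  have hp : ‖(!₂[0, 1, φ] : E3)‖ ≠ 0 := fun h0 => by
    have := congrFun (congrArg WithLp.ofLp (norm_eq_zero.1 h0)) 1
    simp at this
  set N := ‖(!₂[0, 1, φ] : E3)‖ with hN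
  have hv : (!₂[0, 1, φ] : E3) ≠ 0 := norm_ne_zero_iff.1 hp
  have he : (!₂[1, 0, 0] : E3) ≠ 0 := fun h0 => by
    have := congrFun (congrArg WithLp.ofLp h0) 0
    simp at this
  obtain ⟨⟨g, hg⟩, hgx⟩ := h.exists_smul_eq (S2.normalize _ hv) (S2.normalize _ he)
  have h1 : g • (!₂[0, 1, φ] : E3) ∈ icosahedronVertices :=
    mem_fullIcosahedralGroup.1 (hG hg) _
      (mem_icosahedronVertices_0 (s := 1) (t := 1) (by simp) (by simp) (by simp) (by simp) (by simp))
  have h2 : g • (N⁻¹ • (!₂[0, 1, φ] : E3)) = ‖(!₂[1, 0, 0] : E3)‖⁻¹ • (!₂[1, 0, 0] : E3) :=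
    congrArg Subtype.val hgx
  have h3 : g • (!₂[0, 1, φ] : E3) = N • ‖(!₂[1, 0, 0] : E3)‖⁻¹ • (!₂[1, 0, 0] : E3) := by
    rw [← h2, smul_comm g, smul_smul, mul_inv_cancel₀ hp, one_smul]
  rw [h3] at h1
  obtain ⟨s, t, hs, ht, h4⟩ := h1
  have hs0 : s ≠ 0 := by rcases hs with rfl | rfl <;> norm_num
  have ht0 : t * φ ≠ 0 := mul_ne_zero (by rcases ht with rfl | rfl <;> norm_num)
    Real.goldenRatio_ne_zero
  rcases h4 with h4 | h4 | h4
  · have := congrFun (congrArg WithLp.ofLp h4) 1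
    simp at this; exact hs0 this.symm
  · have := congrFun (congrArg WithLp.ofLp h4) 1
    simp at this
    rcases this with h | h
    · rcases ht with rfl | rfl <;> norm_num at h
    · exact ht0 (by rw [Real.goldenRatio, h]; simp)
  · have := congrFun (congrArg WithLp.ofLp h4) 2
    simp at this; exact hs0 this.symm

/-- The rotation of order five about the vertex `(0, 1, φ)`. -/
noncomputable def icosahedralRotFive : O3 :=
  ⟨!![(φ - 1) / 2, -φ / 2, 1 / 2; φ / 2, 1 / 2, (φ - 1) / 2; -1 / 2, (φ - 1) / 2, φ / 2], by
    have h := Real.goldenRatio_sq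
    rw [Matrix.mem_orthogonalGroup_iff]
    ext i j
    fin_cases i <;> fin_cases j <;> simp [Matrix.mul_apply, Fin.sum_univ_three] <;> linarith⟩

/-- The rotation of order three about the face centre `(0, φ ^ 2, 1)`. -/
noncomputable def icosahedralRotThree : O3 :=
  ⟨!![-1 / 2, (1 - φ) / 2, φ / 2; (φ - 1) / 2, φ / 2, 1 / 2; -φ / 2, 1 / 2, (1 - φ) / 2], by
    have h := Real.goldenRatio_sq
    rw [Matrix.mem_orthogonalGroup_iff]
    ext i j
    fin_cases i <;> fin_cases j <;> simp [Matrix.mul_apply, Fin.sum_univ_three] <;> linarith⟩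

theorem icosahedralRotFive_smul (v : E3) : icosahedralRotFive • v =
    !₂[(φ - 1) / 2 * v 0 + -φ / 2 * v 1 + 1 / 2 * v 2,
      φ / 2 * v 0 + 1 / 2 * v 1 + (φ - 1) / 2 * v 2,
      -1 / 2 * v 0 + (φ - 1) / 2 * v 1 + φ / 2 * v 2] := by
  ext i
  fin_cases i <;>
    simp [icosahedralRotFive, Matrix.mulVec, dotProduct, Fin.sum_univ_three]

theorem icosahedralRotThree_smul (v : E3) : icosahedralRotThree • v =
    !₂[-1 / 2 * v 0 + (1 - φ) / 2 * v 1 + φ / 2 * v 2,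
      (φ - 1) / 2 * v 0 + φ / 2 * v 1 + 1 / 2 * v 2,
      -φ / 2 * v 0 + 1 / 2 * v 1 + (1 - φ) / 2 * v 2] := by
  ext i
  fin_cases i <;>
    simp [icosahedralRotThree, Matrix.mulVec, dotProduct, Fin.sum_univ_three]

theorem icosahedralRotFive_mem : icosahedralRotFive ∈ icosahedralGroup := by
  have h := Real.goldenRatio_sq
  refine ⟨mem_fullIcosahedralGroup.2 ?_, ?_⟩
  swap
  · simp [icosahedralRotFive, Matrix.det_fin_three]
    nlinarith
  rintro v ⟨s, t, hs, ht, hv⟩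
  rw [icosahedralRotFive_smul]
  rcases hs with rfl | rfl <;> rcases ht with rfl | rfl <;> rcases hv with rfl | rfl | rfl
  · refine mem_icosahedronVertices_0 (s := 1) (t := 1) (by simp) (by simp) ?_ ?_ ?_ <;> simp <;> linarith
  · refine mem_icosahedronVertices_1 (s := -1) (t := 1) (by simp) (by simp) ?_ ?_ ?_ <;> simp <;> linarith
  · refine mem_icosahedronVertices_1 (s := 1) (t := 1) (by simp) (by simp) ?_ ?_ ?_ <;> simp <;> linarith
  · refine mem_icosahedronVertices_2 (s := -1) (t := -1) (by simp) (by simp) ?_ ?_ ?_ <;> simp <;> linarith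
  · refine mem_icosahedronVertices_2 (s := -1) (t := 1) (by simp) (by simp) ?_ ?_ ?_ <;> simp <;> linarith
  · refine mem_icosahedronVertices_0 (s := -1) (t := 1) (by simp) (by simp) ?_ ?_ ?_ <;> simp <;> linarith
  · refine mem_icosahedronVertices_2 (s := 1) (t := 1) (by simp) (by simp) ?_ ?_ ?_ <;> simp <;> linarith
  · refine mem_icosahedronVertices_2 (s := 1) (t := -1) (by simp) (by simp) ?_ ?_ ?_ <;> simp <;> linarith
  · refine mem_icosahedronVertices_0 (s := 1) (t := -1) (by simp) (by simp) ?_ ?_ ?_ <;> simp <;> linarith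
  · refine mem_icosahedronVertices_0 (s := -1) (t := -1) (by simp) (by simp) ?_ ?_ ?_ <;> simp <;> linarith
  · refine mem_icosahedronVertices_1 (s := 1) (t := -1) (by simp) (by simp) ?_ ?_ ?_ <;> simp <;> linarith
  · refine mem_icosahedronVertices_1 (s := -1) (t := -1) (by simp) (by simp) ?_ ?_ ?_ <;> simp <;> linarith

theorem icosahedralRotThree_mem : icosahedralRotThree ∈ icosahedralGroup := by
  have h := Real.goldenRatio_sq
  refine ⟨mem_fullIcosahedralGroup.2 ?_, ?_⟩
  swap
  · simp [icosahedralRotThree, Matrix.det_fin_three]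
    nlinarith
  rintro v ⟨s, t, hs, ht, hv⟩
  rw [icosahedralRotThree_smul]
  rcases hs with rfl | rfl <;> rcases ht with rfl | rfl <;> rcases hv with rfl | rfl | rfl
  · refine mem_icosahedronVertices_1 (s := 1) (t := 1) (by simp) (by simp) ?_ ?_ ?_ <;> simp <;> linarith
  · refine mem_icosahedronVertices_1 (s := -1) (t := 1) (by simp) (by simp) ?_ ?_ ?_ <;> simp <;> linarith
  · refine mem_icosahedronVertices_0 (s := 1) (t := -1) (by simp) (by simp) ?_ ?_ ?_ <;> simp <;> linarith
  · refine mem_icosahedronVertices_2 (s := 1) (t := -1) (by simp) (by simp) ?_ ?_ ?_ <;> simp <;> linarith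
  · refine mem_icosahedronVertices_0 (s := -1) (t := -1) (by simp) (by simp) ?_ ?_ ?_ <;> simp <;> linarith
  · refine mem_icosahedronVertices_2 (s := 1) (t := 1) (by simp) (by simp) ?_ ?_ ?_ <;> simp <;> linarith
  · refine mem_icosahedronVertices_2 (s := -1) (t := 1) (by simp) (by simp) ?_ ?_ ?_ <;> simp <;> linarith
  · refine mem_icosahedronVertices_0 (s := 1) (t := 1) (by simp) (by simp) ?_ ?_ ?_ <;> simp <;> linarith
  · refine mem_icosahedronVertices_2 (s := -1) (t := -1) (by simp) (by simp) ?_ ?_ ?_ <;> simp <;> linarith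
  · refine mem_icosahedronVertices_1 (s := -1) (t := -1) (by simp) (by simp) ?_ ?_ ?_ <;> simp <;> linarith
  · refine mem_icosahedronVertices_1 (s := 1) (t := -1) (by simp) (by simp) ?_ ?_ ?_ <;> simp <;> linarith
  · refine mem_icosahedronVertices_0 (s := -1) (t := 1) (by simp) (by simp) ?_ ?_ ?_ <;> simp <;> linarith

theorem alphaCos_mul_norm_le {v w : E3} (h0 : 0 ≤ inner ℝ v w)
    (h : alphaCos ^ 2 * (inner ℝ v v * inner ℝ w w) ≤ inner ℝ v w ^ 2) :
    alphaCos * (‖v‖ * ‖w‖) ≤ inner ℝ v w := by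
  refine le_of_sq_le_sq ?_ h0
  rw [mul_pow, mul_pow, ← real_inner_self_eq_norm_sq, ← real_inner_self_eq_norm_sq]
  exact h

/-- The rays spanning the fundamental cone of the icosahedral group. -/
noncomputable def kiteVertex : Fin 4 → E3 :=
  ![!₂[0, 1, φ], !₂[0, φ ^ 2, 1], !₂[1, φ ^ 2, φ], !₂[-1, φ ^ 2, φ]]

theorem kiteVertex_gram (i j : Fin 4) : inner ℝ (kiteVertex i) (kiteVertex j) =
    (!![φ + 2, 2 * φ + 1, 2 * φ + 2, 2 * φ + 2; 2 * φ + 1, 3 * φ + 3, 4 * φ + 2, 4 * φ + 2;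
      2 * φ + 2, 4 * φ + 2, 4 * φ + 4, 4 * φ + 2; 2 * φ + 2, 4 * φ + 2, 4 * φ + 2, 4 * φ + 4] :
      Matrix (Fin 4) (Fin 4) ℝ) i j := by
  have h2 := Real.goldenRatio_sq
  rw [inner_eq_dot]
  fin_cases i <;> fin_cases j <;>
    simp [kiteVertex, Fin.sum_univ_three, dotProduct] <;> nlinarith

/-- The tight off-diagonal pair is `0`, `1`: an icosahedron vertex and the centre of an adjacent
face. -/
theorem kiteVertex_inner (i j : Fin 4) :
    alphaCos * (‖kiteVertex i‖ * ‖kiteVertex j‖) ≤ inner ℝ (kiteVertex i) (kiteVertex j) := by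
  have h2 := Real.goldenRatio_sq
  have h3 : φ ^ 3 = 2 * φ + 1 := by linear_combination (φ + 1) * h2
  have hb := goldenRatio_bounds
  apply alphaCos_mul_norm_le
  · rw [kiteVertex_gram]
    fin_cases i <;> fin_cases j <;> simp <;> linarith
  · rw [alphaCos_sq_eq]
    simp only [kiteVertex_gram]
    fin_cases i <;> fin_cases j <;> simp <;> nlinarith [h2, h3]

/-- Expand bilinearly and compare corner by corner; the triangle inequality gives `1 ≤ ∑ a i *
‖kiteVertex i‖` for a unit vector. -/
theorem inner_ge_of_mem_kite {a b : Fin 4 → ℝ} (ha : ∀ i, 0 ≤ a i) (hb : ∀ i, 0 ≤ b i)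
    {x y : S2} (hx : (x : E3) = ∑ i, a i • kiteVertex i) (hy : (y : E3) = ∑ i, b i • kiteVertex i) :
    alphaCos ≤ inner ℝ (x : E3) (y : E3) := by
  have hn : ∀ {a : Fin 4 → ℝ}, (∀ i, 0 ≤ a i) → ∀ {x : S2},
      (x : E3) = ∑ i, a i • kiteVertex i → 1 ≤ ∑ i, a i * ‖kiteVertex i‖ := by
    intro a ha x hx
    rw [← S2.norm_coe x, hx]
    refine (norm_sum_le _ _).trans_eq (Finset.sum_congr rfl fun i _ => ?_)
    rw [norm_smul, Real.norm_of_nonneg (ha i)]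
  calc alphaCos ≤ alphaCos * ((∑ i, a i * ‖kiteVertex i‖) * ∑ i, b i * ‖kiteVertex i‖) :=
        le_mul_of_one_le_right alphaCos_nonneg (one_le_mul_of_one_le_of_one_le (hn ha hx) (hn hb hy))
    _ = ∑ i, ∑ j, a i * b j * (alphaCos * (‖kiteVertex i‖ * ‖kiteVertex j‖)) := by
        rw [Finset.sum_mul_sum, Finset.mul_sum]
        refine Finset.sum_congr rfl fun i _ => ?_
        rw [Finset.mul_sum]
        exact Finset.sum_congr rfl fun j _ => by ring
    _ ≤ ∑ i, ∑ j, a i * b j * inner ℝ (kiteVertex i) (kiteVertex j) :=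
        Finset.sum_le_sum fun i _ => Finset.sum_le_sum fun j _ =>
          mul_le_mul_of_nonneg_left (kiteVertex_inner i j) (mul_nonneg (ha i) (hb j))
    _ = inner ℝ (x : E3) (y : E3) := by
        rw [hx, hy, sum_inner]
        refine Finset.sum_congr rfl fun i _ => ?_
        rw [inner_sum]
        refine Finset.sum_congr rfl fun j _ => ?_
        rw [inner_smul_left, inner_smul_right, mul_assoc]; rfl

/-- The kite is a Dirichlet domain: the point of the orbit closest to the direction `z`, which lies
inside the kite, satisfies the bisector inequalities against the images of `z` under both rotations
and their inverses. -/
theorem exists_mem_kite (x : S2) : ∃ g ∈ icosahedralGroup, ∃ a : Fin 4 → ℝ, (∀ i, 0 ≤ a i) ∧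
    ((g • x : S2) : E3) = ∑ i, a i • kiteVertex i := by
  set z : E3 := !₂[0, 1, 1] with hz
  obtain ⟨g, hg, hmax⟩ := isClosed_icosahedralGroup.isCompact.exists_isMaxOn
    ⟨1, one_mem icosahedralGroup⟩ (O3.continuous_inner_smul (x : E3) z).continuousOn
  set y : E3 := g • (x : E3) with hy
  have hmax1 : ∀ s ∈ icosahedralGroup, inner ℝ (s • y) z ≤ inner ℝ y z := by
    intro s hs
    have := hmax (mul_mem hs hg)
    simpa [mul_smul, hy] using this
  have hmax2 : ∀ s ∈ icosahedralGroup, inner ℝ y (s • z) ≤ inner ℝ y z := by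
    intro s hs
    have := hmax1 _ (inv_mem hs)
    rwa [inner_smul_left_eq, inv_inv] at this
  have h1 := hmax1 _ icosahedralRotFive_mem
  have h2 := hmax2 _ icosahedralRotFive_mem
  have h3 := hmax1 _ icosahedralRotThree_mem
  have h4 := hmax2 _ icosahedralRotThree_mem
  rw [icosahedralRotFive_smul] at h1 h2
  rw [icosahedralRotThree_smul] at h3 h4
  simp [inner_eq_dot, dotProduct, Fin.sum_univ_three, hz] at h1 h2 h3 h4
  have hb := goldenRatio_bounds
  have hsq := Real.goldenRatio_sq
  have hφ0 := Real.goldenRatio_pos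
  have hcube : φ ^ 3 = 2 * φ + 1 := by linear_combination (φ + 1) * hsq
  refine ⟨g, hg, ?_⟩
  rw [O3.coe_smul, ← hy]
  -- The two walls through the vertex, from the fivefold rotation; `hB` gives the two walls through
  -- the face centre, from the threefold one.
  have hA : (φ - 1) * |y 0| ≤ (2 - φ) * y 1 + (3 - 2 * φ) * y 2 := by
    rcases abs_cases (y 0) with h | h <;> rw [h.1] <;> linarith
  have hB : |y 0| ≤ (1 - φ) * y 1 + φ * y 2 := by
    rcases abs_cases (y 0) with h | h <;> rw [h.1] <;> linarith
  -- The plane `y 0 = 0` cuts the kite into two triangles. The edge midpoint on the side of `y`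
  -- takes weight `|y 0|`, the other takes 0; the first two weights solve the remaining 2 × 2
  -- system, and `hB` and `hA` make them nonnegative.
  refine ⟨![(φ ^ 2 * (y 2 - φ * |y 0|) - (y 1 - φ ^ 2 * |y 0|)) / (2 * φ),
    (φ * (y 1 - φ ^ 2 * |y 0|) - (y 2 - φ * |y 0|)) / (2 * φ), (|y 0| + y 0) / 2,
    (|y 0| - y 0) / 2], ?_, ?_⟩
  · intro i
    fin_cases i
    · refine div_nonneg ?_ (by positivity)
      have : 0 ≤ φ * ((1 - φ) * y 1 + φ * y 2 - |y 0|) :=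
        mul_nonneg hφ0.le (sub_nonneg.2 hB)
      refine this.trans_eq ?_
      linear_combination (-y 1 + |y 0| * φ) * hsq
    · refine div_nonneg ?_ (by positivity)
      have : 0 ≤ φ ^ 3 * ((2 - φ) * y 1 + (3 - 2 * φ) * y 2 - (φ - 1) * |y 0|) :=
        mul_nonneg (by positivity) (sub_nonneg.2 hA)
      refine this.trans_eq ?_
      linear_combination ((2 - φ) * y 1 + (3 - 2 * φ) * y 2 - (φ - 1) * |y 0| + |y 0|) * hcube +
        (-2 * y 1 - 4 * y 2 - 2 * |y 0|) * hsq
    · have := neg_abs_le (y 0)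
      simp only [Fin.reduceFinMk, Matrix.cons_val]
      linarith
    · have := le_abs_self (y 0)
      simp only [Fin.reduceFinMk, Matrix.cons_val]
      linarith
  · ext i
    fin_cases i <;> simp [Fin.sum_univ_four, kiteVertex] <;> field_simp <;> ring_nf
    · linear_combination (-2 * y 1 + 3 * |y 0| + √5 * |y 0|) * sqrt_five_sq
    · linear_combination (-2 * y 2 + |y 0| + √5 * |y 0|) * sqrt_five_sq

theorem icosahedralGroup_inner_ge (x y : S2) :
    ∃ g ∈ icosahedralGroup, alphaCos ≤ inner ℝ (g • (x : E3)) (y : E3) := by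
  obtain ⟨g, hg, a, ha, hx⟩ := exists_mem_kite x
  obtain ⟨k, hk, b, hb, hy⟩ := exists_mem_kite y
  refine ⟨k⁻¹ * g, mul_mem (inv_mem hk) hg, ?_⟩
  have := inner_ge_of_mem_kite ha hb hx hy
  rwa [O3.coe_smul, O3.coe_smul, ← inv_inv k, ← inner_smul_left_eq, ← mul_smul] at this

theorem orbitSpaceDiam_le_of_icosahedralGroup_le {G : Subgroup O3} (h : icosahedralGroup ≤ G) :
    orbitSpaceDiam G ≤ alphaAngle :=
  orbitSpaceDiam_le fun x y =>
    let ⟨g, hg, hxy⟩ := icosahedralGroup_inner_ge x y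
    ⟨g, h hg, hxy⟩

/-! ### Counting the poles of a finite rotation group -/

theorem S2.ne_neg_self (x : S2) : x ≠ -x := by
  intro h
  have h1 := S2.inner_self x
  have h2 : inner ℝ (x : E3) (x : E3) = -1 := by
    nth_rewrite 2 [h]
    rw [coe_neg_sphere, inner_neg_right, h1]
  linarith

/-- This is `1/N + 1/a + 1/b = 1 + 2/n` with `N` the largest order. If `s₀ ≥ 3`, the smaller of `a`,
`b` is 2, the other is 3 and `N < 6`, since otherwise the orbit sizes add up to at most `n`. -/
theorem pole_arith_three {n N a b s₀ s₁ s₂ : ℕ} (h₀ : N * s₀ = n) (h₁ : a * s₁ = n)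
    (h₂ : b * s₂ = n) (ha : 2 ≤ a) (haN : a ≤ N) (hb : 2 ≤ b) (hbN : b ≤ N)
    (hs : s₀ + s₁ + s₂ = n + 2) :
    s₀ ≤ 2 ∨ (N = 3 ∧ s₀ = 4) ∨ (N = 4 ∧ s₀ = 6) ∨ (N = 5 ∧ s₀ = 12) := by
  wlog hab : a ≤ b generalizing a b s₁ s₂
  · exact this h₂ h₁ hb hbN ha haN (by omega) (by omega)
  by_contra! hcon
  have hs0 : 3 ≤ s₀ := by omega
  have hN0 : 0 < N := by omega
  have h02 : s₀ ≤ s₂ := by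
    by_contra! h
    have : b * s₂ < N * s₀ := by nlinarith
    omega
  have ha2 : a = 2 := by
    by_contra h
    have : 3 ≤ a := by omega
    have e1 : 3 * s₁ ≤ n := by nlinarith
    have e2 : 3 * s₂ ≤ n := by nlinarith
    omega
  subst ha2
  have hb3 : b ≤ 3 := by
    by_contra! h
    have e2 : 4 * s₂ ≤ n := by nlinarith
    omega
  interval_cases b
  · omega
  · have hN6 : N < 6 := by
      by_contra! h
      have : 6 * s₀ ≤ n := by nlinarith
      omega
    interval_cases N <;> omega

/-- The orbit with the largest stabiliser is chosen. Each orbit has at most `n/2` elements, which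
leaves at most three orbits; with one or two orbits the count itself makes `s ω ≤ 2`. -/
theorem pole_arith {Ω : Type*} [Fintype Ω] {n : ℕ} (hn : 2 ≤ n) {m s : Ω → ℕ}
    (hms : ∀ ω, m ω * s ω = n) (hm : ∀ ω, 2 ≤ m ω)
    (hsum : ∑ ω, s ω + 2 * (n - 1) = Fintype.card Ω * n) :
    ∃ ω, s ω ≤ 2 ∨ (m ω = 3 ∧ s ω = 4) ∨ (m ω = 4 ∧ s ω = 6) ∨ (m ω = 5 ∧ s ω = 12) := by
  classical
  have hne : Nonempty Ω := by
    by_contra h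
    rw [not_nonempty_iff] at h
    simp at hsum
    omega
  obtain ⟨ω, hω⟩ := Finite.exists_max m
  refine ⟨ω, ?_⟩
  have hk : Fintype.card Ω < 4 := by
    have h1 : 2 * ∑ ω, s ω ≤ Fintype.card Ω * n := by
      rw [Finset.mul_sum, ← smul_eq_mul (Fintype.card Ω), ← Finset.card_univ]
      refine Finset.sum_le_card_nsmul _ _ _ fun ω _ => ?_
      rw [← hms ω]
      exact Nat.mul_le_mul_right _ (hm ω)
    by_contra! h
    have : 4 * n ≤ Fintype.card Ω * n := Nat.mul_le_mul_right _ h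
    omega
  have hcard : (Finset.univ.erase ω).card + 1 = Fintype.card Ω :=
    Finset.card_erase_add_one (Finset.mem_univ ω)
  rw [← Finset.add_sum_erase _ _ (Finset.mem_univ ω), ← hcard] at hsum
  have hlt : (Finset.univ.erase ω).card < 3 := by omega
  interval_cases hc : (Finset.univ.erase ω).card
  · left; omega
  · obtain ⟨a, ha⟩ := Finset.card_eq_one.1 hc
    rw [ha, Finset.sum_singleton] at hsum
    left; omega
  · obtain ⟨a, b, hab, ha⟩ := Finset.card_eq_two.1 hc
    rw [ha, Finset.sum_pair hab] at hsum
    exact pole_arith_three (hms ω) (hms a) (hms b) (hm a) (hω a) (hm b) (hω b) (by omega)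

/-- The points of the sphere with nontrivial stabiliser. -/
def poles (H : Subgroup O3) : Set S2 := {x | ∃ h : H, h ≠ 1 ∧ h • x = x}

theorem smul_mem_poles {H : Subgroup O3} (g : H) {x : S2} (hx : x ∈ poles H) :
    g • x ∈ poles H := by
  obtain ⟨h, h1, hx⟩ := hx
  refine ⟨g * h * g⁻¹, fun h0 => h1 ?_, ?_⟩
  · rwa [mul_inv_eq_one, mul_eq_left] at h0
  · rw [mul_smul, mul_smul, inv_smul_smul, hx]

instance poles.mulAction (H : Subgroup O3) : MulAction H (poles H) where
  smul g x := ⟨g • (x : S2), smul_mem_poles g x.2⟩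
  one_smul x := Subtype.ext (one_smul H (x : S2))
  mul_smul g h x := Subtype.ext (mul_smul g h (x : S2))

theorem stabilizer_poles {H : Subgroup O3} (x : poles H) :
    MulAction.stabilizer H x = MulAction.stabilizer H (x : S2) := by
  ext g
  exact Subtype.ext_iff

theorem fixed_eq_pair {A : O3} (hA : A.1.det = 1) (h1 : A ≠ 1) :
    ∃ p : S2, ∀ x : S2, A • x = x ↔ x = p ∨ x = -p := by
  obtain ⟨p, hp⟩ := O3.exists_fixed hA
  refine ⟨p, fun x => ⟨fun hx => ?_, ?_⟩⟩
  · by_contra! h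
    exact h1 (O3.eq_one_of_fixed hA hp hx h.1 h.2)
  · rintro (rfl | rfl)
    · exact hp
    · rw [O3.smul_neg_S2, hp]

theorem card_stabilizer_mul_card_orbit {H : Subgroup O3} [Finite H] (p : S2) :
    Nat.card (MulAction.stabilizer H p) * Nat.card (MulAction.orbit H p) = Nat.card H := by
  have : Finite (MulAction.orbit H p) := Set.finite_range _
  have := Fintype.ofFinite H
  have := Fintype.ofFinite (MulAction.orbit H p)
  have := Fintype.ofFinite (MulAction.stabilizer H p)
  rw [mul_comm, Nat.card_eq_fintype_card, Nat.card_eq_fintype_card, Nat.card_eq_fintype_card]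
  exact MulAction.card_orbit_mul_card_stabilizer_eq_card_group H p

theorem poles_finite {H : Subgroup O3} [Finite H] (hdet : ∀ h ∈ H, h.1.det = 1) :
    Finite (poles H) := by
  have h1 : (⋃ h : {h : H // h ≠ 1}, {x : S2 | h.1 • x = x}).Finite := by
    refine Set.finite_iUnion fun h => ?_
    obtain ⟨p, hp⟩ := fixed_eq_pair (hdet _ h.1.2) fun h0 => h.2 (Subtype.ext h0)
    refine (Set.toFinite {p, -p}).subset fun x hx => (hp x).1 hx
  refine Set.Finite.subset h1 ?_
  rintro x ⟨h, h1, hx⟩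
  exact Set.mem_iUnion.2 ⟨⟨h, h1⟩, hx⟩

theorem card_fixedBy_poles {H : Subgroup O3} (hdet : ∀ h ∈ H, h.1.det = 1) {h : H}
    (h1 : h ≠ 1) : Nat.card (MulAction.fixedBy (M := H) (poles H) h) = 2 := by
  obtain ⟨p, hp⟩ := fixed_eq_pair (hdet _ h.2) fun h0 => h1 (Subtype.ext h0)
  have e1 : p ∈ poles H := ⟨h, h1, (hp p).2 (Or.inl rfl)⟩
  have e2 : -p ∈ poles H := ⟨h, h1, (hp _).2 (Or.inr rfl)⟩
  have : MulAction.fixedBy (M := H) (poles H) h = {⟨p, e1⟩, ⟨-p, e2⟩} := by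
    ext x
    have hx : h • x = x ↔ h.1 • (x : S2) = x := Subtype.ext_iff
    have k1 : x = ⟨p, e1⟩ ↔ (x : S2) = p := Subtype.ext_iff
    have k2 : x = ⟨-p, e2⟩ ↔ (x : S2) = -p := Subtype.ext_iff
    rw [Set.mem_insert_iff, Set.mem_singleton_iff, k1, k2]
    exact hx.trans (hp x)
  rw [Nat.card_coe_set_eq, this]
  exact Set.ncard_pair fun h0 => S2.ne_neg_self _ (congrArg Subtype.val h0)

/-- Burnside's orbit count for the action on the poles. -/
theorem sum_card_orbit_poles {H : Subgroup O3} [Finite H] [Fintype (poles H)]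
    [Fintype (MulAction.orbitRel.Quotient H (poles H))] (hdet : ∀ h ∈ H, h.1.det = 1) :
    ∑ ω : MulAction.orbitRel.Quotient H (poles H), Nat.card (MulAction.orbit H (ω.out : S2)) +
      2 * (Nat.card H - 1) =
      Fintype.card (MulAction.orbitRel.Quotient H (poles H)) * Nat.card H := by
  classical
  have := Fintype.ofFinite H
  have hburn := MulAction.sum_card_fixedBy_eq_card_orbits_mul_card_group H (poles H)
  have hP := MulAction.card_eq_sum_card_group_div_card_stabilizer H (poles H)
  have h1 : ∀ h : H, Fintype.card (MulAction.fixedBy (M := H) (poles H) h) =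
      if h = 1 then Fintype.card (poles H) else 2 := by
    intro h
    rw [← Nat.card_eq_fintype_card]
    split_ifs with h0
    · rw [h0, Nat.card_coe_set_eq, MulAction.fixedBy_one_eq_univ, Set.ncard_univ,
        Nat.card_eq_fintype_card]
    · exact card_fixedBy_poles hdet h0
  have h2 : ∀ ω : MulAction.orbitRel.Quotient H (poles H),
      Fintype.card H / Fintype.card (MulAction.stabilizer H ω.out) =
        Nat.card (MulAction.orbit H (ω.out : S2)) := by
    intro ω
    rw [← Nat.card_eq_fintype_card, ← Nat.card_eq_fintype_card,
      stabilizer_poles, ← card_stabilizer_mul_card_orbit (ω.out : S2),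
      Nat.mul_div_cancel_left _ Nat.card_pos]
  rw [Finset.sum_congr rfl fun h _ => h1 h, ← Finset.add_sum_erase _ _ (Finset.mem_univ (1 : H)),
    if_pos rfl, Finset.sum_congr rfl fun h hh => if_neg (Finset.ne_of_mem_erase hh),
    Finset.sum_const, Finset.card_erase_of_mem (Finset.mem_univ _), smul_eq_mul,
    Finset.card_univ, hP, Finset.sum_congr rfl fun ω _ => h2 ω, mul_comm _ 2,
    ← Nat.card_eq_fintype_card (α := H)] at hburn
  exact hburn

theorem exists_pole {H : Subgroup O3} [Finite H] (hdet : ∀ h ∈ H, h.1.det = 1) :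
    ∃ p : S2, Nat.card (MulAction.orbit H p) ≤ 2 ∨
      (Nat.card (MulAction.stabilizer H p) = 3 ∧ Nat.card (MulAction.orbit H p) = 4) ∨
      (Nat.card (MulAction.stabilizer H p) = 4 ∧ Nat.card (MulAction.orbit H p) = 6) ∨
      (Nat.card (MulAction.stabilizer H p) = 5 ∧ Nat.card (MulAction.orbit H p) = 12) := by
  classical
  have hos : ∀ p : S2, Nat.card (MulAction.stabilizer H p) * Nat.card (MulAction.orbit H p) =
      Nat.card H :=
    card_stabilizer_mul_card_orbit
  -- The trivial group has no poles; any point then has an orbit of size one.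
  rcases subsingleton_or_nontrivial H with hsub | hnt
  · obtain ⟨p, -⟩ := O3.exists_fixed (A := 1) Matrix.det_one
    refine ⟨p, Or.inl ?_⟩
    have h1 := hos p
    have h2 : Nat.card H = 1 := Nat.card_unique
    rw [h2] at h1
    have := Nat.eq_one_of_mul_eq_one_left h1
    omega
  have hn : 2 ≤ Nat.card H := Finite.one_lt_card
  have := poles_finite hdet
  have := Fintype.ofFinite (poles H)
  have := Fintype.ofFinite (MulAction.orbitRel.Quotient H (poles H))
  have htwo : ∀ x : poles H, 2 ≤ Nat.card (MulAction.stabilizer H (x : S2)) := by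
    rintro ⟨x, h, h1, hx⟩
    have : Nontrivial (MulAction.stabilizer H x) :=
      ⟨⟨⟨h, hx⟩, 1, fun h0 => h1 (congrArg Subtype.val h0)⟩⟩
    exact Finite.one_lt_card
  obtain ⟨ω, hω⟩ := pole_arith (Ω := MulAction.orbitRel.Quotient H (poles H)) hn
    (m := fun ω => Nat.card (MulAction.stabilizer H (ω.out : S2)))
    (s := fun ω => Nat.card (MulAction.orbit H (ω.out : S2)))
    (fun ω => hos (ω.out : S2)) (fun ω => htwo ω.out) (sum_card_orbit_poles hdet)
  exact ⟨(ω.out : S2), hω⟩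

/-! ### Lines through an orbit -/

theorem O3.eq_one_of_fixed_subgroup {H : Subgroup O3} (hdet : ∀ h ∈ H, h.1.det = 1) {t : H}
    {p q : S2} (hp : t • p = p) (hq : t • q = q) (h : q ≠ p) (h' : q ≠ -p) : t = 1 :=
  Subtype.ext (O3.eq_one_of_fixed (hdet _ t.2) hp hq h h')

theorem inner_smul_S2 {H : Subgroup O3} (t : H) (x y : S2) :
    inner ℝ ((t • x : S2) : E3) ((t • y : S2) : E3) = inner ℝ (x : E3) (y : E3) :=
  O3.inner_smul_smul t.1 x y

theorem subgroup_smul_neg {H : Subgroup O3} (t : H) (x : S2) : t • (-x) = -(t • x) :=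
  O3.smul_neg_S2 t.1 x

theorem pow_card_stabilizer {H : Subgroup O3} [Finite H] {p : S2} {t : H} (ht : t • p = p) :
    t ^ Nat.card (MulAction.stabilizer H p) = 1 :=
  congrArg Subtype.val
    (pow_card_eq_one' (G := MulAction.stabilizer H p) (x := ⟨t, ht⟩))

theorem eq_one_of_odd_pow {G : Type*} [Group G] {t : G} {N : ℕ} (hN : Odd N) (h : t ^ N = 1)
    (h2 : t ^ 2 = 1) : t = 1 := by
  obtain ⟨k, rfl⟩ := hN
  rwa [pow_add, pow_mul, h2, one_pow, one_mul, pow_one] at h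

/-- If `t q = -q`, then `t²` fixes both `p` and `q`, so `t² = 1`, and the odd exponent gives `t =
1`. -/
theorem smul_ne_of_odd {H : Subgroup O3} [Finite H] (hdet : ∀ h ∈ H, h.1.det = 1) {p q : S2}
    (hN : Odd (Nat.card (MulAction.stabilizer H p))) {t : H} (ht : t • p = p) (ht1 : t ≠ 1)
    (h : q ≠ p) (h' : q ≠ -p) : t • q ≠ q ∧ t • q ≠ -q := by
  refine ⟨fun h0 => ht1 (O3.eq_one_of_fixed_subgroup hdet ht h0 h h'), fun h0 => ht1 ?_⟩
  refine eq_one_of_odd_pow hN (pow_card_stabilizer ht)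
    (O3.eq_one_of_fixed_subgroup hdet (p := p) (q := q) ?_ ?_ h h')
  · rw [pow_two, mul_smul, ht, ht]
  · rw [pow_two, mul_smul, h0, subgroup_smul_neg, h0, neg_neg]

/-- The stabiliser of `p` acts freely off the axis through `p`. -/
theorem ncard_stabilizer_smul {H : Subgroup O3} (hdet : ∀ h ∈ H, h.1.det = 1) {p q : S2}
    (h : q ≠ p) (h' : q ≠ -p) :
    (Set.range fun t : MulAction.stabilizer H p => t.1 • q).ncard =
      Nat.card (MulAction.stabilizer H p) := by
  rw [← Nat.card_coe_set_eq]
  refine Nat.card_range_of_injective fun s t hst => ?_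
  have h1 : (t⁻¹ * s).1 • q = q := by
    change (t.1⁻¹ * s.1) • q = q
    rw [mul_smul]
    exact inv_smul_eq_iff.2 hst
  have h2 := O3.eq_one_of_fixed_subgroup hdet (t⁻¹ * s).2 h1 h h'
  exact (inv_mul_eq_one.1 (Subtype.ext h2)).symm

/-- The union of the orbit of `p` and the orbit of its antipode. -/
def lineOrbit (H : Subgroup O3) (p : S2) : Set S2 :=
  {x | x ∈ MulAction.orbit H p ∨ -x ∈ MulAction.orbit H p}

section lineOrbit

variable {H : Subgroup O3} {p q x : S2}

theorem self_mem_lineOrbit : p ∈ lineOrbit H p := Or.inl (MulAction.mem_orbit_self p)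

theorem neg_mem_lineOrbit (hx : x ∈ lineOrbit H p) : -x ∈ lineOrbit H p := by
  rcases hx with hx | hx
  · exact Or.inr (by rwa [neg_neg])
  · exact Or.inl hx

theorem smul_mem_lineOrbit (t : H) (hx : x ∈ lineOrbit H p) : t • x ∈ lineOrbit H p := by
  rcases hx with hx | hx
  · exact Or.inl (MulAction.mem_orbit_of_mem_orbit t hx)
  · exact Or.inr (by rw [← subgroup_smul_neg]; exact MulAction.mem_orbit_of_mem_orbit t hx)

theorem finite_lineOrbit [Finite H] : (lineOrbit H p).Finite := by
  have h1 : (MulAction.orbit H p).Finite := Set.finite_range _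
  refine (h1.union (h1.image fun x => -x)).subset ?_
  rintro x (hx | hx)
  · exact Or.inl hx
  · exact Or.inr ⟨-x, hx, neg_neg x⟩

theorem ncard_lineOrbit_le [Finite H] :
    (lineOrbit H p).ncard ≤ 2 * Nat.card (MulAction.orbit H p) := by
  have h1 : (MulAction.orbit H p).Finite := Set.finite_range _
  have h2 : lineOrbit H p ⊆ MulAction.orbit H p ∪ (fun x => -x) '' MulAction.orbit H p := by
    rintro x (hx | hx)
    · exact Or.inl hx
    · exact Or.inr ⟨-x, hx, neg_neg x⟩
  refine (Set.ncard_le_ncard h2 (h1.union (h1.image _))).trans ?_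
  refine (Set.ncard_union_le _ _).trans ?_
  have := Set.ncard_image_le (f := fun x : S2 => -x) h1
  rw [Nat.card_coe_set_eq]
  omega

theorem lineOrbit_eq_orbit (hp : -p ∈ MulAction.orbit H p) :
    lineOrbit H p = MulAction.orbit H p := by
  refine Set.Subset.antisymm ?_ fun x hx => Or.inl hx
  rintro x (hx | ⟨h, hx⟩)
  · exact hx
  · have h1 : x = h • -p := by
      rw [subgroup_smul_neg, show h • p = -x from hx, neg_neg]
    rw [h1]
    exact MulAction.mem_orbit_of_mem_orbit h hp

theorem stabilizer_neg (x : S2) : MulAction.stabilizer H (-x) = MulAction.stabilizer H x := by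
  ext t
  rw [MulAction.mem_stabilizer_iff, MulAction.mem_stabilizer_iff, subgroup_smul_neg, neg_inj]

theorem card_stabilizer_of_mem_lineOrbit [Finite H] (hx : x ∈ lineOrbit H p) :
    Nat.card (MulAction.stabilizer H x) = Nat.card (MulAction.stabilizer H p) := by
  have key : ∀ y ∈ MulAction.orbit H p,
      Nat.card (MulAction.stabilizer H y) = Nat.card (MulAction.stabilizer H p) := by
    intro y hy
    have h1 := card_stabilizer_mul_card_orbit (H := H) y
    rw [MulAction.orbit_eq_iff.2 hy, ← card_stabilizer_mul_card_orbit (H := H) p] at h1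
    have : Finite (MulAction.orbit H p) := Set.finite_range _
    have : Nonempty (MulAction.orbit H p) := ⟨⟨p, MulAction.mem_orbit_self p⟩⟩
    exact Nat.eq_of_mul_eq_mul_right Nat.card_pos h1
  rcases hx with hx | hx
  · exact key x hx
  · rw [← stabilizer_neg]; exact key _ hx

theorem exists_mem_lineOrbit_ne (hp : 2 < (lineOrbit H p).ncard) (x : S2) :
    ∃ q ∈ lineOrbit H p, q ≠ x ∧ q ≠ -x := by
  by_contra! h
  have h1 : lineOrbit H p ⊆ {x, -x} := fun q hq => by
    by_cases h2 : q = x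
    · exact Or.inl h2
    · exact Or.inr (h q hq h2)
  have := Set.ncard_le_ncard h1 (Set.toFinite _)
  rw [Set.ncard_pair (S2.ne_neg_self x)] at this
  omega

/-- With `S` the stabiliser of `p`, of order `N`, the sets `S q`, `S (-q)` and `{p, -p}` are
disjoint, the first two because `N` is odd. They already account for `2N + 2` points, so no room is
left for another `x`. -/
theorem exists_stabilizer_smul_eq [Finite H] (hdet : ∀ h ∈ H, h.1.det = 1) {o : S2}
    (hN : Odd (Nat.card (MulAction.stabilizer H p)))
    (hcard : (lineOrbit H o).ncard ≤ 2 * Nat.card (MulAction.stabilizer H p) + 2)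
    (hp : p ∈ lineOrbit H o) (hq : q ∈ lineOrbit H o) (hx : x ∈ lineOrbit H o)
    (hqp : q ≠ p) (hqp' : q ≠ -p) (hxp : x ≠ p) (hxp' : x ≠ -p) :
    ∃ t : H, t • p = p ∧ (x = t • q ∨ x = -(t • q)) := by
  by_contra! hcon
  have hnp : (-q) ≠ p := fun h => hqp' (by rw [← h, neg_neg])
  have hnp' : (-q) ≠ -p := fun h => hqp (neg_inj.1 h)
  set A := Set.range fun t : MulAction.stabilizer H p => t.1 • q with hA
  set B := Set.range fun t : MulAction.stabilizer H p => t.1 • -q with hB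
  have hAc := ncard_stabilizer_smul (H := H) hdet hqp hqp'
  have hBc := ncard_stabilizer_smul (H := H) hdet hnp hnp'
  have hfix : ∀ (t : MulAction.stabilizer H p), t.1 • p = p := fun t => t.2
  have hmove : ∀ (t : MulAction.stabilizer H p) (y : S2), t.1 • y = p → y = p := fun t y h =>
    MulAction.injective t.1 (h.trans (hfix t).symm)
  have hmove' : ∀ (t : MulAction.stabilizer H p) (y : S2), t.1 • y = -p → y = -p := fun t y h =>
    MulAction.injective t.1 (h.trans ((subgroup_smul_neg _ _).trans (by rw [hfix])).symm)
  have hAB : Disjoint A B := by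
    rw [Set.disjoint_left]
    rintro _ ⟨s, rfl⟩ ⟨t, ht⟩
    have ht' : t.1 • -q = s.1 • q := ht
    have h1 : (t⁻¹ * s).1 • q = -q := by
      change (t.1⁻¹ * s.1) • q = -q
      rw [mul_smul, ← ht', inv_smul_smul]
    by_cases h2 : (t⁻¹ * s).1 = 1
    · rw [h2, one_smul] at h1
      exact S2.ne_neg_self q h1
    · exact (smul_ne_of_odd hdet hN (t⁻¹ * s).2 h2 hqp hqp').2 h1
  have hC : Disjoint (A ∪ B) {p, -p} := by
    rw [Set.disjoint_left]
    rintro y (⟨t, rfl⟩ | ⟨t, rfl⟩) (h | h)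
    · exact hqp (hmove t _ h)
    · exact hqp' (hmove' t _ h)
    · exact hnp (hmove t _ h)
    · exact hnp' (hmove' t _ h)
  have hD : Disjoint (A ∪ B ∪ {p, -p}) {x} := by
    rw [Set.disjoint_singleton_right]
    rintro ((⟨t, ht⟩ | ⟨t, ht⟩) | (h | h))
    · exact (hcon t.1 t.2).1 ht.symm
    · exact (hcon t.1 t.2).2 (by rw [← subgroup_smul_neg]; exact ht.symm)
    · exact hxp h
    · exact hxp' h
  have hAf : A.Finite := Set.finite_range _
  have hBf : B.Finite := Set.finite_range _
  have hsub : A ∪ B ∪ {p, -p} ∪ {x} ⊆ lineOrbit H o := by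
    rintro y (((⟨t, rfl⟩ | ⟨t, rfl⟩) | (rfl | rfl)) | rfl)
    · exact smul_mem_lineOrbit _ hq
    · exact smul_mem_lineOrbit _ (neg_mem_lineOrbit hq)
    · exact hp
    · exact neg_mem_lineOrbit hp
    · exact hx
  have hle := Set.ncard_le_ncard hsub finite_lineOrbit
  rw [Set.ncard_union_eq hD ((hAf.union hBf).union (Set.toFinite _)) (Set.toFinite _),
    Set.ncard_union_eq hC (hAf.union hBf) (Set.toFinite _), Set.ncard_union_eq hAB hAf hBf,
    Set.ncard_pair (S2.ne_neg_self p), Set.ncard_singleton, hAc, hBc] at hle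
  omega

theorem abs_inner_eq_of_stabilizer {t : H} (ht : t • p = p) (h : x = t • q ∨ x = -(t • q)) :
    |inner ℝ (p : E3) (x : E3)| = |inner ℝ (p : E3) (q : E3)| := by
  have h1 := inner_smul_S2 t p q
  rw [ht] at h1
  rcases h with rfl | rfl
  · rw [h1]
  · rw [coe_neg_sphere, inner_neg_right, abs_neg, h1]

/-- The lines through an orbit with odd stabiliser of large order are equiangular. -/
theorem exists_equiangular [Finite H] (hdet : ∀ h ∈ H, h.1.det = 1)
    (hN : Odd (Nat.card (MulAction.stabilizer H p)))
    (hcard : (lineOrbit H p).ncard ≤ 2 * Nat.card (MulAction.stabilizer H p) + 2)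
    (h2 : 2 < (lineOrbit H p).ncard) :
    ∃ h : ℝ, 0 ≤ h ∧ h < 1 ∧ ∀ x ∈ lineOrbit H p, ∀ y ∈ lineOrbit H p, y ≠ x → y ≠ -x →
      |inner ℝ (x : E3) (y : E3)| = h := by
  obtain ⟨q, hq, hqp, hqp'⟩ := exists_mem_lineOrbit_ne h2 p
  have hp : p ∈ lineOrbit H p := self_mem_lineOrbit
  -- Each line makes one common angle with all the others; symmetry of the inner product then links
  -- the angles at different lines.
  have key : ∀ x ∈ lineOrbit H p, ∀ y ∈ lineOrbit H p, ∀ z ∈ lineOrbit H p,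
      y ≠ x → y ≠ -x → z ≠ x → z ≠ -x →
      |inner ℝ (x : E3) (z : E3)| = |inner ℝ (x : E3) (y : E3)| := by
    intro x hx y hy z hz h1 h2 h3 h4
    obtain ⟨t, ht, h⟩ := exists_stabilizer_smul_eq hdet (p := x) (q := y) (x := z) (o := p)
      (by rwa [card_stabilizer_of_mem_lineOrbit hx])
      (by rwa [card_stabilizer_of_mem_lineOrbit hx]) hx hy hz h1 h2 h3 h4
    exact abs_inner_eq_of_stabilizer ht h
  refine ⟨|inner ℝ (p : E3) (q : E3)|, abs_nonneg _, ?_, ?_⟩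
  · rw [real_inner_comm]; exact S2.abs_inner_lt_one hqp hqp'
  intro x hx y hy h1 h2
  by_cases hxp : x = p
  · rw [hxp] at h1 h2 ⊢
    exact key p hp q hq y hy hqp hqp' h1 h2
  by_cases hxp' : x = -p
  · rw [hxp', coe_neg_sphere, inner_neg_left, abs_neg]
    rw [hxp'] at h1 h2
    rw [neg_neg] at h2
    exact key p hp q hq y hy hqp hqp' h2 h1
  · rw [key x hx p hp y hy (Ne.symm hxp) (fun h => hxp' (by rw [h, neg_neg])) h1 h2,
      real_inner_comm]
    exact key p hp q hq x hx hqp hqp' hxp hxp'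

/-- An `l`-group has, modulo `l`, as many fixed points on the orbit as the orbit has elements. So
`p` is not the only point fixed by its stabiliser, and the other one must be `-p`. -/
theorem neg_mem_orbit_of_isPGroup [Finite H] (hdet : ∀ h ∈ H, h.1.det = 1) {l : ℕ}
    [Fact l.Prime] (hS : IsPGroup l (MulAction.stabilizer H p))
    (hnt : 1 < Nat.card (MulAction.stabilizer H p))
    (hmod : ¬ Nat.card (MulAction.orbit H p) ≡ 1 [MOD l]) : -p ∈ MulAction.orbit H p := by
  have : Finite (MulAction.orbit H p) := Set.finite_range _
  obtain ⟨b, hb, hne⟩ : ∃ b : MulAction.orbit H p,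
      b ∈ MulAction.fixedPoints (MulAction.stabilizer H p) (MulAction.orbit H p) ∧
      ⟨p, MulAction.mem_orbit_self p⟩ ≠ b := by
    by_contra! h
    refine hmod ((hS.card_modEq_card_fixedPoints (MulAction.orbit H p)).trans ?_)
    have h1 : MulAction.fixedPoints (MulAction.stabilizer H p) (MulAction.orbit H p) =
        {⟨p, MulAction.mem_orbit_self p⟩} :=
      Set.eq_singleton_iff_unique_mem.2 ⟨fun t => Subtype.ext t.2, fun b hb => (h b hb).symm⟩
    rw [h1, Nat.card_unique]
  have : Nontrivial (MulAction.stabilizer H p) := Finite.one_lt_card_iff_nontrivial.1 hnt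
  obtain ⟨t, ht⟩ := exists_ne (1 : MulAction.stabilizer H p)
  have hbt : t.1 • (b : S2) = b := congrArg Subtype.val (hb t)
  have hbp : (b : S2) ≠ p := fun h => hne (Subtype.ext h.symm)
  by_cases h : (b : S2) = -p
  · rw [← h]; exact b.2
  · exact absurd (Subtype.ext (O3.eq_one_of_fixed_subgroup hdet t.2 hbt hbp h)) ht

/-- The stabiliser orbit of `q` together with `±p` fills the whole set, so it contains `-q`. -/
theorem exists_stabilizer_smul_eq_neg [Finite H] (hdet : ∀ h ∈ H, h.1.det = 1)
    (hcard : (lineOrbit H p).ncard ≤ Nat.card (MulAction.stabilizer H p) + 2)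
    (hq : q ∈ lineOrbit H p) (hqp : q ≠ p) (hqp' : q ≠ -p) :
    ∃ t : H, t • p = p ∧ t • q = -q := by
  by_contra! hcon
  set A := Set.range fun t : MulAction.stabilizer H p => t.1 • q with hA
  have hAc := ncard_stabilizer_smul (H := H) hdet hqp hqp'
  have hfix : ∀ (t : MulAction.stabilizer H p), t.1 • p = p := fun t => t.2
  have hC : Disjoint A {p, -p} := by
    rw [Set.disjoint_left]
    rintro y ⟨t, rfl⟩ (h | h)
    · exact hqp (MulAction.injective t.1 (h.trans (hfix t).symm))
    · exact hqp' (MulAction.injective t.1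
        (Eq.trans h ((subgroup_smul_neg _ _).trans (by rw [hfix])).symm))
  have hD : Disjoint (A ∪ {p, -p}) {-q} := by
    rw [Set.disjoint_singleton_right]
    rintro (⟨t, ht⟩ | (h | h))
    · exact hcon t.1 t.2 ht
    · exact hqp' (by rw [← h, neg_neg])
    · exact hqp (neg_inj.1 h)
  have hAf : A.Finite := Set.finite_range _
  have hsub : A ∪ {p, -p} ∪ {-q} ⊆ lineOrbit H p := by
    rintro y ((⟨t, rfl⟩ | (rfl | rfl)) | rfl)
    · exact smul_mem_lineOrbit _ hq
    · exact self_mem_lineOrbit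
    · exact neg_mem_lineOrbit self_mem_lineOrbit
    · exact neg_mem_lineOrbit hq
  have hle := Set.ncard_le_ncard hsub finite_lineOrbit
  rw [Set.ncard_union_eq hD (hAf.union (Set.toFinite _)) (Set.toFinite _),
    Set.ncard_union_eq hC hAf (Set.toFinite _),
    Set.ncard_pair (S2.ne_neg_self p), Set.ncard_singleton, hAc] at hle
  omega

end lineOrbit

/-! ### Deep holes of the finite configurations -/

theorem O3.eq_inner_smul_of_fixed {A : O3} (hA : A.1.det = 1) (h1 : A ≠ 1) {p : S2}
    (hp : A • p = p) {v : E3} (hv : A • v = v) : v = inner ℝ v (p : E3) • (p : E3) := by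
  have hp' : A • (p : E3) = p := congrArg Subtype.val hp
  set u := v - inner ℝ v (p : E3) • (p : E3) with hu
  have hAu : A • u = u := by rw [hu, smul_sub, hv, smul_comm A, hp']
  have hup : inner ℝ (p : E3) u = 0 := by
    rw [hu, inner_sub_right, inner_smul_right, S2.inner_self, mul_one, real_inner_comm, sub_self]
  by_contra hne
  have hu0 : u ≠ 0 := fun h => hne (sub_eq_zero.1 h)
  have hw : inner ℝ (p : E3) (S2.normalize u hu0 : E3) = 0 := by
    rw [S2.inner_normalize, hup, zero_div]
  refine h1 (O3.eq_one_of_fixed hA hp (q := S2.normalize u hu0) ?_ ?_ ?_)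
  · refine Subtype.ext ?_
    rw [O3.coe_smul, S2.normalize]
    exact (smul_comm A _ _).trans (by rw [hAu])
  · intro h
    rw [h, S2.inner_self] at hw
    exact one_ne_zero hw
  · intro h
    rw [h, coe_neg_sphere, inner_neg_right, S2.inner_self] at hw
    norm_num at hw

section finite

variable {H : Subgroup O3} {p : S2}

theorem exists_witness {v : E3} {M : ℝ} (hM : ∀ x ∈ lineOrbit H p, |inner ℝ (x : E3) v| ≤ M)
    (h0 : 0 < inner ℝ v v) (hv : M ^ 2 ≤ alphaCos ^ 2 * inner ℝ v v) :
    ∃ x w : S2, ∀ h : H, |inner ℝ ((h • x : S2) : E3) (w : E3)| ≤ alphaCos := by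
  have hv0 : v ≠ 0 := inner_self_ne_zero.1 h0.ne'
  refine ⟨p, S2.normalize v hv0, fun h => ?_⟩
  have hn : 0 < ‖v‖ := norm_pos_iff.2 hv0
  rw [S2.inner_normalize, abs_div, abs_of_pos hn, div_le_iff₀ hn]
  refine (hM _ (smul_mem_lineOrbit h self_mem_lineOrbit)).trans ?_
  refine le_of_sq_le_sq ?_ (mul_nonneg alphaCos_nonneg hn.le)
  rwa [mul_pow, ← real_inner_self_eq_norm_sq]

theorem abs_inner_eq_one {x y : S2} (h : x = y ∨ x = -y) :
    |inner ℝ (x : E3) (y : E3)| = 1 := by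
  rcases h with rfl | rfl
  · rw [S2.inner_self, abs_one]
  · rw [coe_neg_sphere, inner_neg_left, S2.inner_self, abs_neg, abs_one]

theorem abs_inner_eq_abs_inner {x y : S2} {z : E3} (h : x = y ∨ x = -y) :
    |inner ℝ (x : E3) z| = |inner ℝ (y : E3) z| := by
  rcases h with rfl | rfl
  · rfl
  · rw [coe_neg_sphere, inner_neg_left, abs_neg]

theorem abs_inner_le_one (x y : S2) : |inner ℝ (x : E3) (y : E3)| ≤ 1 := by
  simpa [S2.norm_coe] using abs_real_inner_le_norm (x : E3) (y : E3)

theorem exists_witness_of_card_le_two (hs : Nat.card (MulAction.orbit H p) ≤ 2) [Finite H] :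
    ∃ x w : S2, ∀ h : H, |inner ℝ ((h • x : S2) : E3) (w : E3)| ≤ alphaCos := by
  have hfin : (MulAction.orbit H p).Finite := Set.finite_range _
  obtain ⟨q, hq⟩ : ∃ q, MulAction.orbit H p ⊆ {p, q} := by
    by_contra! h
    obtain ⟨a, ha, hap⟩ := Set.not_subset.1 (h p)
    obtain ⟨b, hb, hbp⟩ := Set.not_subset.1 (h a)
    have hsub : ({p, a, b} : Set S2) ⊆ MulAction.orbit H p := by
      rintro x (rfl | rfl | rfl)
      exacts [MulAction.mem_orbit_self _, ha, hb]
    have h1 := Set.ncard_le_ncard hsub hfin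
    have h2 : ({p, a, b} : Set S2).ncard = 3 :=
      Set.ncard_eq_three.2 ⟨p, a, b, fun h => hap (by simp [h]), fun h => hbp (by simp [h]),
        fun h => hbp (by simp [h]), rfl⟩
    rw [Nat.card_coe_set_eq] at hs
    omega
  obtain ⟨w, h1, h2⟩ := exists_S2_perp p q
  refine ⟨p, w, fun h => ?_⟩
  rcases hq (MulAction.mem_orbit p h) with h3 | h3
  · rw [show h • p = p from h3, h1, abs_zero]; exact alphaCos_nonneg
  · rw [show h • p = q from h3, h2, abs_zero]; exact alphaCos_nonneg

theorem exists_witness_of_add {q : S2} {M : ℝ}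
    (hM : ∀ x ∈ lineOrbit H p, |inner ℝ (x : E3) (p : E3)| + |inner ℝ (x : E3) (q : E3)| ≤ M)
    (h0 : 0 ≤ inner ℝ (p : E3) (q : E3))
    (hv : M ^ 2 ≤ alphaCos ^ 2 * (2 + 2 * inner ℝ (p : E3) (q : E3))) :
    ∃ x w : S2, ∀ h : H, |inner ℝ ((h • x : S2) : E3) (w : E3)| ≤ alphaCos := by
  have hvv : inner ℝ ((p : E3) + q) ((p : E3) + q) = 2 + 2 * inner ℝ (p : E3) (q : E3) := by
    rw [real_inner_add_add_self, S2.inner_self, S2.inner_self]; ring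
  refine exists_witness (H := H) (p := p) (v := (p : E3) + q) (M := M) (fun x hx => ?_)
    (by rw [hvv]; linarith) (by rw [hvv]; exact hv)
  rw [inner_add_right]
  exact (abs_add_le _ _).trans (hM x hx)

theorem alphaCos_sq_ge : 3 / 5 ≤ alphaCos ^ 2 := by
  rw [alphaCos_sq]; exact three_fifths_lt

theorem exists_witness_of_octahedral [Finite H] (hdet : ∀ h ∈ H, h.1.det = 1)
    (hN : Nat.card (MulAction.stabilizer H p) = 4) (hs : Nat.card (MulAction.orbit H p) = 6) :
    ∃ x w : S2, ∀ h : H, |inner ℝ ((h • x : S2) : E3) (w : E3)| ≤ alphaCos := by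
  have : Fact (Nat.Prime 2) := ⟨Nat.prime_two⟩
  have hneg := neg_mem_orbit_of_isPGroup (p := p) hdet (l := 2)
    (IsPGroup.of_card (n := 2) (by rw [hN]; rfl)) (by omega) (by rw [hs]; decide)
  have hc : (lineOrbit H p).ncard = 6 := by
    rw [lineOrbit_eq_orbit hneg, ← hs, Nat.card_coe_set_eq]
  obtain ⟨q, hq, hqp, hqp'⟩ := exists_mem_lineOrbit_ne (H := H) (p := p) (by omega) p
  have key : ∀ x ∈ lineOrbit H p, x ≠ p → x ≠ -p → inner ℝ (x : E3) (p : E3) = 0 := by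
    intro x hx h1 h2
    -- A rotation fixing `p` and sending `x` to `-x` forces `x ⊥ p`.
    obtain ⟨t, htp, htx⟩ := exists_stabilizer_smul_eq_neg hdet (by omega) hx h1 h2
    have := inner_smul_S2 t x p
    rw [htp, htx, coe_neg_sphere, inner_neg_left] at this
    linarith
  have hpq : inner ℝ (p : E3) (q : E3) = 0 := by rw [real_inner_comm]; exact key q hq hqp hqp'
  refine exists_witness_of_add (H := H) (p := p) (q := q) (M := 1) (fun x hx => ?_) hpq.ge
    (by rw [hpq]; linarith [alphaCos_sq_ge])
  by_cases hxp : x = p ∨ x = -p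
  · rw [abs_inner_eq_one hxp, abs_inner_eq_abs_inner hxp, hpq, abs_zero, add_zero]
  · push Not at hxp
    rw [key x hx hxp.1 hxp.2, abs_zero, zero_add]
    exact abs_inner_le_one x q

/-- Given equiangular lines, two coordinates with respect to distinct lines. -/
theorem abs_add_abs_le_of_equiangular {c : ℝ} (hE : ∀ x ∈ lineOrbit H p, ∀ y ∈ lineOrbit H p,
    y ≠ x → y ≠ -x → |inner ℝ (x : E3) (y : E3)| = c) {a b x : S2} (ha : a ∈ lineOrbit H p)
    (hb : b ∈ lineOrbit H p) (hx : x ∈ lineOrbit H p) (hab : b ≠ a) (hab' : b ≠ -a) :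
    |inner ℝ (x : E3) (a : E3)| + |inner ℝ (x : E3) (b : E3)| ≤ 1 + c := by
  by_cases hxa : x = a ∨ x = -a
  · rw [abs_inner_eq_one hxa, abs_inner_eq_abs_inner hxa, hE a ha b hb hab hab']
  · push Not at hxa
    rw [real_inner_comm, hE a ha x hx hxa.1 hxa.2, add_comm]
    exact add_le_add_left (abs_inner_le_one x b) _

theorem exists_mem_lineOrbit_inner_nonneg (h2 : 2 < (lineOrbit H p).ncard) :
    ∃ q ∈ lineOrbit H p, q ≠ p ∧ q ≠ -p ∧ 0 ≤ inner ℝ (p : E3) (q : E3) := by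
  obtain ⟨q, hq, hqp, hqp'⟩ := exists_mem_lineOrbit_ne h2 p
  rcases le_total 0 (inner ℝ (p : E3) (q : E3)) with h | h
  · exact ⟨q, hq, hqp, hqp', h⟩
  · refine ⟨-q, neg_mem_lineOrbit hq, fun h1 => hqp' (by rw [← h1, neg_neg]),
      fun h1 => hqp (neg_inj.1 h1), ?_⟩
    rw [coe_neg_sphere, inner_neg_right]
    linarith

theorem exists_ne_one_stabilizer [Finite H] (h : 1 < Nat.card (MulAction.stabilizer H p)) :
    ∃ t : H, t • p = p ∧ t ≠ 1 := by
  have : Nontrivial (MulAction.stabilizer H p) := Finite.one_lt_card_iff_nontrivial.1 h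
  obtain ⟨t, ht⟩ := exists_ne (1 : MulAction.stabilizer H p)
  exact ⟨t.1, t.2, fun h => ht (Subtype.ext h)⟩

/-- The sum of the `t ^ i • q` is fixed by `t`, hence equals `N ⟪p, q⟫ p`; pair it with `q`. -/
theorem sum_inner_pow_smul {q : S2} {t : H} {N : ℕ} (hdet : t.1.1.det = 1) (htp : t • p = p)
    (ht1 : t ≠ 1) (htN : t ^ N = 1) :
    ∑ i ∈ Finset.range N, inner ℝ ((t ^ i • q : S2) : E3) (q : E3) =
      N * inner ℝ (p : E3) (q : E3) ^ 2 := by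
  set v : E3 := ∑ i ∈ Finset.range N, ((t ^ i • q : S2) : E3) with hv
  have htv : t.1 • v = v := by
    have h1 : t.1 • v = ∑ i ∈ Finset.range N, ((t ^ (i + 1) • q : S2) : E3) := by
      rw [hv, Finset.smul_sum]
      refine Finset.sum_congr rfl fun i _ => ?_
      rw [pow_succ', mul_smul]
      rfl
    have h2 := Finset.sum_range_succ (fun i => ((t ^ i • q : S2) : E3)) N
    rw [Finset.sum_range_succ', htN, pow_zero] at h2
    rw [h1]
    exact add_right_cancel h2
  have hvp := O3.eq_inner_smul_of_fixed hdet (fun h => ht1 (Subtype.ext h)) htp htv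
  have hip : ∀ i, inner ℝ ((t ^ i • q : S2) : E3) (p : E3) = inner ℝ (p : E3) (q : E3) := by
    intro i
    induction i with
    | zero => rw [pow_zero, one_smul, real_inner_comm]
    | succ i ih => rw [pow_succ', mul_smul, ← ih, ← inner_smul_S2 t (t ^ i • q) p, htp]
  have h1 : inner ℝ v (p : E3) = N * inner ℝ (p : E3) (q : E3) := by
    rw [hv, sum_inner, Finset.sum_congr rfl fun i _ => hip i, Finset.sum_const,
      Finset.card_range, nsmul_eq_mul]
  rw [← sum_inner, ← hv, hvp, inner_smul_left, h1, conj_trivial]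
  ring

theorem inner_pow_smul_symm {q : S2} {t : H} {i j : ℕ} (h : t ^ (i + j) = 1) :
    inner ℝ ((t ^ i • q : S2) : E3) (q : E3) = inner ℝ ((t ^ j • q : S2) : E3) (q : E3) := by
  rw [← inner_smul_S2 (t ^ j) (t ^ i • q) q, ← mul_smul, ← pow_add, add_comm, h, one_smul,
    real_inner_comm]

theorem exists_witness_of_tetrahedral [Finite H] (hdet : ∀ h ∈ H, h.1.det = 1)
    (hN : Nat.card (MulAction.stabilizer H p) = 3) (hs : Nat.card (MulAction.orbit H p) = 4) :
    ∃ x w : S2, ∀ h : H, |inner ℝ ((h • x : S2) : E3) (w : E3)| ≤ alphaCos := by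
  have hle := ncard_lineOrbit_le (H := H) (p := p)
  have hge : 4 ≤ (lineOrbit H p).ncard := by
    rw [← hs, Nat.card_coe_set_eq]
    exact Set.ncard_le_ncard (fun x hx => Or.inl hx) finite_lineOrbit
  have hodd : Odd (Nat.card (MulAction.stabilizer H p)) := by rw [hN]; decide
  obtain ⟨c, hc0, hc1, hE⟩ := exists_equiangular (H := H) (p := p) hdet hodd (by omega) (by omega)
  obtain ⟨q, hq, hqp, hqp', hpq⟩ := exists_mem_lineOrbit_inner_nonneg (H := H) (p := p) (by omega)
  obtain ⟨t, htp, ht1⟩ := exists_ne_one_stabilizer (H := H) (p := p) (by omega)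
  have ha : inner ℝ (p : E3) (q : E3) = c := by
    rw [← hE p self_mem_lineOrbit q hq hqp hqp', abs_of_nonneg hpq]
  have ht3 := pow_card_stabilizer htp
  rw [hN] at ht3
  have hq' := smul_mem_lineOrbit t hq
  have hne := smul_ne_of_odd hdet hodd htp ht1 hqp hqp'
  have hk := hE q hq _ hq' hne.1 hne.2
  have hsum := sum_inner_pow_smul (q := q) (hdet _ t.2) htp ht1 ht3
  rw [Finset.sum_range_succ, Finset.sum_range_succ, Finset.sum_range_one,
    inner_pow_smul_symm (i := 2) (j := 1) ht3, pow_zero, pow_one, one_smul, S2.inner_self, ha,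
    real_inner_comm] at hsum
  set k := inner ℝ (q : E3) ((t • q : S2) : E3) with hkdef
  push_cast at hsum
  -- The orbit sum reads `1 + 2k = 3c²` with `k = ±c`; the sign `k = c` is incompatible with `0 ≤ c
  -- < 1`.
  have hkc : k = -c := by
    rcases (abs_eq hc0).1 hk with h | h
    · rw [h] at hsum
      have : (1 - c) * (3 * c + 1) = 0 := by linarith
      have h1 : 0 < (1 - c) * (3 * c + 1) := mul_pos (by linarith) (by linarith)
      linarith
    · exact h
  have hc : c = 1 / 3 := by
    rw [hkc] at hsum
    have : (3 * c - 1) * (c + 1) = 0 := by linarith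
    rcases mul_eq_zero.1 this with h | h <;> linarith
  -- The pair `q`, `t q` is obtuse, so `v` points along a fourfold axis of the cube with these
  -- diagonals, and the squared cosine is 1/3. An acute pair would give 2/3, which exceeds `cos² α`.
  have hqv : inner ℝ (q : E3) ((q : E3) + (t • q : S2)) = 2 / 3 := by
    rw [inner_add_right, S2.inner_self, ← hkdef, hkc, hc]; norm_num
  have hqv' : inner ℝ ((t • q : S2) : E3) ((q : E3) + (t • q : S2)) = 2 / 3 := by
    rw [inner_add_right, S2.inner_self, real_inner_comm, ← hkdef, hkc, hc]; norm_num
  have hvv : inner ℝ ((q : E3) + (t • q : S2)) ((q : E3) + (t • q : S2)) = 4 / 3 := by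
    rw [inner_add_left, hqv, hqv']; norm_num
  refine exists_witness (H := H) (p := p) (v := (q : E3) + (t • q : S2)) (M := 2 / 3)
    (fun x hx => ?_) (by rw [hvv]; norm_num) (by rw [hvv]; linarith [alphaCos_sq_ge])
  by_cases hxq : x = q ∨ x = -q
  · rw [abs_inner_eq_abs_inner hxq, hqv, abs_of_nonneg (by norm_num)]
  by_cases hxq' : x = t • q ∨ x = -(t • q)
  · rw [abs_inner_eq_abs_inner hxq', hqv', abs_of_nonneg (by norm_num)]
  push Not at hxq hxq'
  rw [inner_add_right]
  refine (abs_add_le _ _).trans ?_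
  rw [real_inner_comm, hE q hq x hx hxq.1 hxq.2, real_inner_comm,
    hE _ hq' x hx hxq'.1 hxq'.2, hc]
  norm_num

/-- The lines through the vertices of a regular icosahedron: the centre of a face is a deep
hole. -/
theorem exists_witness_of_face {c : ℝ} (hc0 : 0 ≤ c) (hc1 : c < 1) (hc : 5 * c ^ 2 = 1)
    (hE : ∀ x ∈ lineOrbit H p, ∀ y ∈ lineOrbit H p,
      y ≠ x → y ≠ -x → |inner ℝ (x : E3) (y : E3)| = c) {q r : S2} (hq : q ∈ lineOrbit H p)
    (hr : r ∈ lineOrbit H p) (hpq : inner ℝ (p : E3) (q : E3) = c)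
    (hpr : inner ℝ (p : E3) (r : E3) = c) (hqr : inner ℝ (q : E3) (r : E3) = c) :
    ∃ x w : S2, ∀ h : H, |inner ℝ ((h • x : S2) : E3) (w : E3)| ≤ alphaCos := by
  have hne : ∀ {a b : S2}, inner ℝ (a : E3) (b : E3) = c → b ≠ a ∧ b ≠ -a := by
    intro a b hab
    constructor
    · rintro rfl
      rw [S2.inner_self] at hab
      linarith
    · rintro rfl
      rw [coe_neg_sphere, inner_neg_right, S2.inner_self] at hab
      linarith
  have hvv : inner ℝ ((p : E3) + q + r) ((p : E3) + q + r) = 3 + 6 * c := by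
    rw [real_inner_add_add_self, real_inner_add_add_self, inner_add_left, S2.inner_self,
      S2.inner_self, S2.inner_self, hpq, hpr, hqr]
    ring
  refine exists_witness (H := H) (p := p) (v := (p : E3) + q + r) (M := 1 + 2 * c)
    (fun x hx => ?_) (by rw [hvv]; linarith) ?_
  · rw [inner_add_right, inner_add_right]
    have h1 := abs_add_abs_le_of_equiangular hE hq hr hx (hne hqr).1 (hne hqr).2
    have h2 := abs_add_le (inner ℝ (x : E3) (p : E3) + inner ℝ (x : E3) (q : E3))
      (inner ℝ (x : E3) (r : E3))
    have h3 := abs_add_le (inner ℝ (x : E3) (p : E3)) (inner ℝ (x : E3) (q : E3))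
    by_cases hxp : x = p ∨ x = -p
    · have h4 := abs_inner_eq_one hxp
      have h5 := abs_inner_eq_abs_inner (z := q) hxp
      have h6 := abs_inner_eq_abs_inner (z := r) hxp
      rw [hpq, abs_of_nonneg hc0] at h5
      rw [hpr, abs_of_nonneg hc0] at h6
      linarith
    · push Not at hxp
      have h4 := hE p self_mem_lineOrbit x hx hxp.1 hxp.2
      rw [real_inner_comm] at h4
      linarith
  · have h5 := sqrt_five_sq
    have h50 : (0 : ℝ) < √5 := by positivity
    have hcs : 2 / √5 = 2 * c := by
      rw [div_eq_iff h50.ne']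
      have : (c * √5) ^ 2 = 1 ^ 2 := by rw [mul_pow, h5]; linarith
      have := (sq_eq_sq₀ (by positivity) zero_le_one).1 this
      linarith
    rw [hvv, alphaCos_sq, hcs]
    exact le_of_eq (by ring)

theorem exists_witness_of_icosahedral [Finite H] (hdet : ∀ h ∈ H, h.1.det = 1)
    (hN : Nat.card (MulAction.stabilizer H p) = 5) (hs : Nat.card (MulAction.orbit H p) = 12) :
    ∃ x w : S2, ∀ h : H, |inner ℝ ((h • x : S2) : E3) (w : E3)| ≤ alphaCos := by
  have : Fact (Nat.Prime 5) := ⟨Nat.prime_five⟩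
  have hodd : Odd (Nat.card (MulAction.stabilizer H p)) := by rw [hN]; decide
  have hneg := neg_mem_orbit_of_isPGroup (p := p) hdet (l := 5)
    (IsPGroup.of_card (n := 1) (by rw [hN]; rfl)) (by omega) (by rw [hs]; decide)
  have hc : (lineOrbit H p).ncard = 12 := by
    rw [lineOrbit_eq_orbit hneg, ← hs, Nat.card_coe_set_eq]
  obtain ⟨c, hc0, hc1, hE⟩ := exists_equiangular (H := H) (p := p) hdet hodd (by omega) (by omega)
  obtain ⟨q, hq, hqp, hqp', hpq⟩ := exists_mem_lineOrbit_inner_nonneg (H := H) (p := p) (by omega)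
  obtain ⟨t, htp, ht1⟩ := exists_ne_one_stabilizer (H := H) (p := p) (by omega)
  have ha : inner ℝ (p : E3) (q : E3) = c := by
    rw [← hE p self_mem_lineOrbit q hq hqp hqp', abs_of_nonneg hpq]
  have ht5 := pow_card_stabilizer htp
  rw [hN] at ht5
  have htp2 : t ^ 2 • p = p := by rw [pow_two, mul_smul, htp, htp]
  have ht21 : t ^ 2 ≠ 1 := fun h => ht1 (eq_one_of_odd_pow (N := 5) (by decide) ht5 h)
  have hne := smul_ne_of_odd hdet hodd htp ht1 hqp hqp'
  have hne2 := smul_ne_of_odd hdet hodd htp2 ht21 hqp hqp'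
  have hk1 := hE q hq _ (smul_mem_lineOrbit t hq) hne.1 hne.2
  have hk2 := hE q hq _ (smul_mem_lineOrbit (t ^ 2) hq) hne2.1 hne2.2
  have hsum := sum_inner_pow_smul (q := q) (hdet _ t.2) htp ht1 ht5
  rw [Finset.sum_range_succ, Finset.sum_range_succ, Finset.sum_range_succ, Finset.sum_range_succ,
    Finset.sum_range_one, inner_pow_smul_symm (i := 4) (j := 1) ht5,
    inner_pow_smul_symm (i := 3) (j := 2) ht5, pow_zero, pow_one, one_smul, S2.inner_self, ha,
    real_inner_comm, real_inner_comm (q : E3) ((t ^ 2 • q : S2) : E3)] at hsum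
  have hpt : ∀ {s : H}, s • p = p → inner ℝ (p : E3) ((s • q : S2) : E3) = c := fun {s} hsp => by
    rw [← ha, ← inner_smul_S2 s p q, hsp]
  push_cast at hsum
  -- The orbit sum reads `1 + 2k₁ + 2k₂ = 5c²` with `k₁, k₂ = ±c`. Two plus signs are impossible,
  -- and mixed signs give `5c² = 1` with a face spanned by `p`, `q` and the image of `q` at inner
  -- product `c`.
  rcases (abs_eq hc0).1 hk1 with h1 | h1 <;> rcases (abs_eq hc0).1 hk2 with h2 | h2
  · rw [h1, h2] at hsum
    have h3 : 0 < (1 - c) * (5 * c + 1) := mul_pos (by linarith) (by linarith)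
    linarith
  · rw [h1, h2] at hsum
    exact exists_witness_of_face hc0 hc1 (by linarith) hE hq (smul_mem_lineOrbit t hq) ha
      (hpt htp) h1
  · rw [h1, h2] at hsum
    exact exists_witness_of_face hc0 hc1 (by linarith) hE hq (smul_mem_lineOrbit (t ^ 2) hq) ha
      (hpt htp2) h2
  · rw [h1, h2] at hsum
    have hc5 : c = 1 / 5 := by
      have : (5 * c - 1) * (c + 1) = 0 := by linarith
      rcases mul_eq_zero.1 this with h | h <;> linarith
    refine exists_witness_of_add (H := H) (p := p) (q := q) (M := 1 + c) (fun x hx => ?_) hpq ?_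
    · exact abs_add_abs_le_of_equiangular hE self_mem_lineOrbit hq hx hqp hqp'
    · rw [ha, hc5]; linarith [alphaCos_sq_ge]

theorem exists_witness_of_finite [Finite H] (hdet : ∀ h ∈ H, h.1.det = 1) :
    ∃ x w : S2, ∀ h : H, |inner ℝ ((h • x : S2) : E3) (w : E3)| ≤ alphaCos := by
  obtain ⟨p, h | ⟨h1, h2⟩ | ⟨h1, h2⟩ | ⟨h1, h2⟩⟩ := exists_pole hdet
  · exact exists_witness_of_card_le_two h
  · exact exists_witness_of_tetrahedral hdet h1 h2
  · exact exists_witness_of_octahedral hdet h1 h2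
  · exact exists_witness_of_icosahedral hdet h1 h2

end finite

/-! ### From rotation groups to all finite groups, and the conclusion -/

theorem O3.det_neg (A : O3) : (-A).1.det = -A.1.det := by
  change (-A.1).det = _
  rw [Matrix.det_neg]; norm_num

/-- The rotations `±A` with `A` in `G`. -/
def rotationPart (G : Subgroup O3) : Subgroup O3 where
  carrier := {A | A.1.det = 1 ∧ (A ∈ G ∨ -A ∈ G)}
  one_mem' := ⟨Matrix.det_one, Or.inl (one_mem G)⟩
  mul_mem' := by
    rintro A B ⟨hA, hA'⟩ ⟨hB, hB'⟩
    refine ⟨(Matrix.det_mul A.1 B.1).trans (by rw [hA, hB, one_mul]), ?_⟩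
    rcases hA' with hA' | hA' <;> rcases hB' with hB' | hB'
    · exact Or.inl (mul_mem hA' hB')
    · exact Or.inr (by rw [← mul_neg]; exact mul_mem hA' hB')
    · exact Or.inr (by rw [← neg_mul]; exact mul_mem hA' hB')
    · exact Or.inl (by rw [← neg_mul_neg]; exact mul_mem hA' hB')
  inv_mem' := by
    rintro A ⟨hA, hA'⟩
    constructor
    · change (star A.1).det = 1
      rw [Matrix.star_eq_conjTranspose, Matrix.det_conjTranspose, hA, star_one]
    · rcases hA' with hA' | hA'
      · exact Or.inl (inv_mem hA')
      · have : -A⁻¹ = (-A)⁻¹ := by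
          rw [eq_inv_iff_mul_eq_one, neg_mul_neg, inv_mul_cancel]
        exact Or.inr (by rw [this]; exact inv_mem hA')

theorem O3.neg_smul_E3 (A : O3) (x : E3) : (-A) • x = -(A • x) := by
  rw [O3.smul_def, O3.smul_def]
  change WithLp.toLp 2 ((-A.1).mulVec x.ofLp) = _
  rw [Matrix.neg_mulVec]; rfl

theorem O3.det_eq (A : O3) : A.1.det = 1 ∨ A.1.det = -1 := by
  have h := congrArg Matrix.det ((Matrix.mem_orthogonalGroup_iff (Fin 3) ℝ).1 A.2)
  rw [Matrix.det_mul, Matrix.det_transpose, Matrix.det_one] at h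
  exact mul_self_eq_one_iff.1 h

/-- For each `g ∈ G`, one of `±g` is a rotation in `rotationPart G`, and the witness bounds absolute
values, so the sign is harmless. -/
theorem alphaAngle_le_diam_of_finite {G : Subgroup O3} (hfin : (G : Set O3).Finite) :
    alphaAngle ≤ orbitSpaceDiam G := by
  have hRf : (rotationPart G : Set O3).Finite := by
    refine (hfin.union (hfin.image fun A => -A)).subset ?_
    rintro A ⟨-, hA | hA⟩
    · exact Or.inl hA
    · exact Or.inr ⟨-A, hA, neg_neg A⟩
  have : Finite (rotationPart G) := hRf
  obtain ⟨x, w, hxw⟩ := exists_witness_of_finite (H := rotationPart G) fun h hh => hh.1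
  refine alphaAngle_le_diam (x := x) (w := w) fun g hg => ?_
  rcases O3.det_eq g with h1 | h1
  · exact (le_abs_self _).trans (hxw ⟨g, h1, Or.inl hg⟩)
  · have h2 := hxw ⟨-g, by rw [O3.det_neg, h1, neg_neg], Or.inr (by rwa [neg_neg])⟩
    have h3 : inner ℝ ((-g) • (x : E3)) (w : E3) = -inner ℝ (g • (x : E3)) (w : E3) := by
      rw [O3.neg_smul_E3, inner_neg_left]
    have h4 : |inner ℝ ((-g) • (x : E3)) (w : E3)| ≤ alphaCos := h2
    rw [h3, abs_neg] at h4
    exact (le_abs_self _).trans h4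

theorem mainTheorem6 :
    (∀ G : Subgroup O3, IsClosed (G : Set O3) → ¬ MulAction.IsPretransitive G S2 →
      alphaAngle ≤ orbitSpaceDiam G) ∧
    (IsClosed (icosahedralGroup : Set O3) ∧ ¬ MulAction.IsPretransitive icosahedralGroup S2 ∧
      orbitSpaceDiam icosahedralGroup = alphaAngle) ∧
    (IsClosed (fullIcosahedralGroup : Set O3) ∧
      ¬ MulAction.IsPretransitive fullIcosahedralGroup S2 ∧
      orbitSpaceDiam fullIcosahedralGroup = alphaAngle) := by
  have hlow : ∀ G : Subgroup O3, IsClosed (G : Set O3) → ¬ MulAction.IsPretransitive G S2 →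
      alphaAngle ≤ orbitSpaceDiam G := by
    intro G hG hnt
    by_cases hfin : (G : Set O3).Finite
    · exact alphaAngle_le_diam_of_finite hfin
    · exact alphaAngle_le_diam_of_infinite hG hfin hnt
  have hI := not_isPretransitive_of_le_fullIcosahedralGroup icosahedralGroup_le
  have hIh := not_isPretransitive_of_le_fullIcosahedralGroup le_rfl
  exact ⟨hlow, ⟨isClosed_icosahedralGroup, hI,
    (orbitSpaceDiam_le_of_icosahedralGroup_le le_rfl).antisymm
      (hlow _ isClosed_icosahedralGroup hI)⟩,
    isClosed_fullIcosahedralGroup, hIh,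
    (orbitSpaceDiam_le_of_icosahedralGroup_le icosahedralGroup_le).antisymm
      (hlow _ isClosed_fullIcosahedralGroup hIh)⟩
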